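/- Notation. For integers $d\ge 1$ and $\lambda\ge 1$ let $N=\lfloor\sqrt\lambda\rfloor$, $S_{\sqrt\lambda}=\{x\in\mathbb R^d:|x|=\sqrt\lambda\}$, let $\sigma$ be the surface measure on the unit sphere $S^{d-1}\subset\mathbb R^d$ and $\mathcal F\sigma(\eta)=\int_{S^{d-1}}e^{-2\pi i\eta\cdot\theta}\,d\sigma(\theta)$. For $\xi\in\mathbb T^d=\mathbb R^d/\mathbb Z^d$ put $\hat w_\lambda(\xi)=\sum_{x\in S_{\sqrt\lambda}\cap\mathbb Z^d}e^{2\pi i\xi\cdot x}$. For coprime $p,q$ and $x\in\mathbb Z^d$ let $$G(p/q;x)=q^{-d}\sum_{n\in\{1,\dots,q\}^d}e^{2\pi i(|n|^2p/q+x\cdot n/q)}.$$ For $y\in\mathbb R^d$ let $[y]\in\mathbb Z^d$ be the integer vector with $y-[y]\in[-1/2,1/2)^d$. Let $\varphi\in C_c^\infty((-1/4,1/4))$ with $\varphi=1$ on $[-1/8,1/8]$ and $\|\varphi\|_\infty\le 1$, and let $\psi(y)=\prod_{j=1}^d\varphi(y_j)$. Define $$M_1(\lambda,\xi,n)=\tfrac12\lambda^{d/2-1}\sum_{\substack{1\le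 q\le N\\ q<n}}\ \sum_{\substack{1\le p\le q\\(p,q)=1}}e^{-2\pi i\lambda p/q}\,G(p/q;[q\xi])\,\mathcal F\sigma\big(\sqrt\lambda([q\xi]/q-\xi)\big),$$ $$M_2(\lambda,\xi,n)=\tfrac12\lambda^{d/2-1}\sum_{n\le q\le N}\ \sum_{\substack{1\le p\le q\\(p,q)=1}}\ \sum_{x\in\mathbb Z^d}e^{-2\pi i\lambda p/q}\,G(p/q;x)\,\psi(q\xi-x)\,\mathcal F\sigma\big(\sqrt\lambda(x/q-\xi)\big),$$ $$\mathfrak S_d(\lambda)=\sum_{q=1}^\infty\ \sum_{\substack{1\le p\le q\\(p,q)=1}}e^{-2\pi i\lambda p/q}\,G(p/q;0).$$ Theorem 3.1. For all integers $d\ge16$ and $\lambda\ge1$ the series $\mathfrak S_d(\lambda)$ converges, is real, and satisfies $\tfrac12\le\mathfrak S_d(\lambda)\le\tfrac32$. Moreover, there are absolute constants $C,K,c_1,c_2>0$ (independent also of $\varphi$) such that the following hold. (i) For all integers $d\ge5$ and $\lambda>0$ with $\lambda\ge Cd^3$, all integers $1\le n\le N+1$ and all $\xi\in\mathbb T^d$,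 $$|\hat w_\lambda(\xi)-M_1(\lambda,\xi,n)-M_2(\lambda,\xi,n)|\le K^d(d\lambda)^{d/4},$$ and in particular (for $n=N+1$) $|\hat w_\lambda(\xi)-M_1(\lambda,\xi,N+1)|\le K^d(d\lambda)^{d/4}$. (ii) As $d\to\infty$, uniformly in the integers $\lambda\ge Cd^3$, $$|S_{\sqrt\lambda}\cap\mathbb Z^d|=\frac{\pi^{d/2}}{\Gamma(d/2)}\lambda^{d/2-1}\,\mathfrak S_d(\lambda)\,(1+o(1)).$$ (iii) For all integers $d\ge16$ and $\lambda\ge Cd^3$, both $|S_{\sqrt\lambda}\cap\mathbb Z^d|$ and $\sigma(S^{d-1})\lambda^{d/2-1}$ lie between $c_1\frac{\pi^{d/2}}{\Gamma(d/2)}\lambda^{d/2-1}$ and $c_2\frac{\pi^{d/2}}{\Gamma(d/2)}\lambda^{d/2-1}$. -/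

import Mathlib

open Set MeasureTheory
open scoped ContDiff

noncomputable section

namespace DimFreeWaring

/-- The lattice points of the sphere of radius `√lam` centred at the origin of `ℝ^d`, that is,
the integer vectors `x` with `|x|² = lam`. -/
def latticeSphere (d lam : ℕ) : Set (Fin d → ℤ) :=
  {x | ∑ i, x i ^ 2 = (lam : ℤ)}

theorem latticeSphere_finite (d lam : ℕ) : (latticeSphere d lam).Finite := by
  refine (Set.finite_Icc (fun _ : Fin d => -(lam : ℤ)) (fun _ => (lam : ℤ))).subset ?_
  intro x hx
  have h : ∀ i, x i ^ 2 ≤ (lam : ℤ) := by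
    intro i
    have hx' : ∑ i, x i ^ 2 = (lam : ℤ) := hx
    rw [← hx']
    exact Finset.single_le_sum (f := fun i => x i ^ 2) (fun j _ => sq_nonneg (x j))
      (Finset.mem_univ i)
  refine ⟨fun i => ?_, fun i => ?_⟩
  · nlinarith [h i, Int.le_self_sq (-(x i))]
  · exact (Int.le_self_sq (x i)).trans (h i)

/-- The exponential sum over the lattice points of the sphere of radius `√lam`: the sum of
`e^{2πi ξ·x}`. It is periodic in `ξ` with respect to `ℤ^d`. -/
def wHat (d lam : ℕ) (ξ : Fin d → ℝ) : ℂ :=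
  ∑ x ∈ (latticeSphere_finite d lam).toFinset,
    Complex.exp (2 * Real.pi * Complex.I * (∑ i, ξ i * (x i : ℝ) : ℝ))

/-- The canonical surface measure on the unit sphere of the Euclidean space `ℝ^d`. -/
def surfaceMeasure (d : ℕ) : Measure (Metric.sphere (0 : EuclideanSpace ℝ (Fin d)) 1) :=
  (volume : Measure (EuclideanSpace ℝ (Fin d))).toSphere

/-- The Fourier transform of the surface measure: the integral of `e^{-2πi η·θ}` over the unit
sphere. -/
def surfaceFourier (d : ℕ) (η : Fin d → ℝ) : ℂ :=
  ∫ θ : Metric.sphere (0 : EuclideanSpace ℝ (Fin d)) 1,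
    Complex.exp (-(2 * Real.pi * Complex.I * (∑ i, η i * θ.1 i : ℝ))) ∂(surfaceMeasure d)

/-- The normalized `d`-dimensional Gauss sum `G(p/q; x)`, where `n` runs over `{1, …, q}^d`. -/
def gaussG (d p q : ℕ) (x : Fin d → ℤ) : ℂ :=
  ((q : ℂ) ^ d)⁻¹ * ∑ n ∈ Fintype.piFinset (fun _ : Fin d => Finset.Icc 1 q),
    Complex.exp (2 * Real.pi * Complex.I *
      (((∑ i, (n i : ℝ) ^ 2) * p / q + (∑ i, (x i : ℝ) * (n i : ℝ)) / q : ℝ)))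

/-- The numerators `p` of the reduced fractions `p/q` modulo one: `1 ≤ p ≤ q`, `(p, q) = 1`.
(The fractions `0` and `1` are identified.) -/
def numerators (q : ℕ) : Finset ℕ :=
  (Finset.Icc 1 q).filter (fun p => Nat.Coprime p q)

/-- The twist `e^{-2πi lam p/q}`. -/
def twist (lam p q : ℕ) : ℂ :=
  Complex.exp (-(2 * Real.pi * Complex.I * ((lam : ℝ) * p / q : ℝ)))

/-- The nearest integer vector to `y`: the integer vector `x` with `y - x ∈ [-1/2, 1/2)^d`
(`round` rounds half-integers up). -/
def nearest {d : ℕ} (y : Fin d → ℝ) : Fin d → ℤ := fun i => round (y i)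

/-- Smooth cutoff functions: smooth with compact support in `(-1/4, 1/4)`, equal to one on
`[-1/8, 1/8]`, and bounded by one. -/
structure IsCutoff (φ : ℝ → ℂ) : Prop where
  smooth : ContDiff ℝ ∞ φ
  compactSupport : HasCompactSupport φ
  tsupport_subset : tsupport φ ⊆ Ioo (-(1 / 4)) (1 / 4)
  eq_one : ∀ x ∈ Icc (-(1 / 8) : ℝ) (1 / 8), φ x = 1
  norm_le_one : ∀ x, ‖φ x‖ ≤ 1

/-- The tensor product `ψ(y) = φ(y_1) ⋯ φ(y_d)`. -/
def tensorCutoff (φ : ℝ → ℂ) {d : ℕ} (y : Fin d → ℝ) : ℂ := ∏ i, φ (y i)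

/-- The first major arc term: the contribution of the reduced fractions with denominators
`q ≤ ⌊√lam⌋`, `q < n`. -/
def majorOne (d lam n : ℕ) (ξ : Fin d → ℝ) : ℂ :=
  (1 / 2 : ℂ) * (((lam : ℝ) ^ ((d : ℝ) / 2 - 1) : ℝ) : ℂ) *
    ∑ q ∈ (Finset.Icc 1 (Nat.sqrt lam)).filter (fun q => q < n), ∑ p ∈ numerators q,
      twist lam p q * gaussG d p q (nearest (fun i => (q : ℝ) * ξ i)) *
        surfaceFourier d (fun i =>
          Real.sqrt lam * ((nearest (fun i => (q : ℝ) * ξ i) i : ℝ) / q - ξ i))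

/-- The second major arc term: the contribution of the reduced fractions with denominators
`q ≤ ⌊√lam⌋`, `n ≤ q`. The sum over `x ∈ ℤ^d` has at most one nonzero term if `φ` is a cutoff
function. -/
def majorTwo (φ : ℝ → ℂ) (d lam n : ℕ) (ξ : Fin d → ℝ) : ℂ :=
  (1 / 2 : ℂ) * (((lam : ℝ) ^ ((d : ℝ) / 2 - 1) : ℝ) : ℂ) *
    ∑ q ∈ (Finset.Icc 1 (Nat.sqrt lam)).filter (fun q => n ≤ q), ∑ p ∈ numerators q,
      ∑' x : Fin d → ℤ, twist lam p q * gaussG d p q x *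
        tensorCutoff φ (fun i => (q : ℝ) * ξ i - (x i : ℝ)) *
        surfaceFourier d (fun i => Real.sqrt lam * ((x i : ℝ) / q - ξ i))

/-- The `q`-th term of the singular series. It vanishes (as an empty sum) for `q = 0`. -/
def singularTerm (d lam q : ℕ) : ℂ :=
  ∑ p ∈ numerators q, twist lam p q * gaussG d p q 0

/-- The singular series. -/
def singularSeries (d lam : ℕ) : ℂ := ∑' q : ℕ, singularTerm d lam q

/-- The quantity `π^{d/2} / Γ(d/2) · lam^{d/2-1}`. -/
def mainTerm (d lam : ℕ) : ℝ :=
  Real.pi ^ ((d : ℝ) / 2) / Real.Gamma ((d : ℝ) / 2) * (lam : ℝ) ^ ((d : ℝ) / 2 - 1)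

end DimFreeWaring

end

open DimFreeWaring

/-!
The proof is the circle method with a smooth weight. Put `ε = 1 / lam` and `N = ⌊√lam⌋`. The
exponential sum over the sphere is the Fourier coefficient of index `lam` of the product of the
`d` theta functions `∑ₘ e^{2πi (α + iε) m² + 2πi m ξᵢ}` (`wHat_eq_integral`); the factor `e^{2π ε
lam} = e^{2π}` needed to undo the weight is bounded.

Near a reduced fraction, `α = p / q + τ`, Poisson summation in residue classes modulo `q` expands
each theta function into Gaussians centred at the points `x / q`, weighted by Gauss sums
(`theta_eq_tsum_thetaTerm`). With `a = 2 (ε - iτ)`, the term of index `x` has size at most a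
constant times `(lam v) ^ (1 / 4) e^{-π v (x - q ξ)²}`, where `v = 2 ε / (q ‖a‖)²`. Keeping only
the integer nearest to `q ξᵢ` in each coordinate therefore costs, after multiplying the
coordinates, a constant to the power `d` times `(lam v) ^ (d / 4) e^{-c v}`, which is at most `K ^
d (d lam) ^ (d / 4)` for all `v` bounded below (`norm_prod_theta_sub_le`). The same bound holds
for the main term itself as soon as some `q ξᵢ` stays at distance `1 / 8` from the integers, so
that the cutoff `ψ` may be inserted or omitted freely for any set of denominators.

Instead of a Farey dissection, the disjoint arcs `|τ| < 1 / (2 q N)` with `q ≤ N` are used. Off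
these arcs, Dirichlet's approximation theorem gives a fraction for which `v` is bounded above and
below, so the whole generating function is within the error term there
(`norm_prod_theta_sub_arcs_le`).

Completing the integral of the main term over an arc to the whole line is cheap
(`norm_arc_sub_singular_le`), and the completed integral is evaluated by Fourier inversion: the
Gaussian integral in polar coordinates says that `a ^ (-d / 2) e^{-π |η|² / a}` is the Fourier
transform of `s ↦ ½ s ^ (d / 2 - 1) 𝓕σ(√s η) e^{-2π ε s}` on the half-line (`integral_arcKernel`).
This gives the approximation in all dimensions `d ≥ 5` (`norm_wHat_sub_weightedMajor_le`).

For `d ≥ 16` the singular series is close to its first term `1`: the term of the denominator `2`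
vanishes, and the others are bounded by `q (2 / q) ^ 8` (`norm_singularTerm_le`). At `ξ = 0` the
main term is `π^{d/2} / Γ(d/2) · lam^{d/2-1}` times the singular series truncated at `N`, and
since `Γ(d/2)` is at most `2 d ^ (d / 2)`, the error term is smaller by a factor of `d` once `lam
≥ C d³` (`error_le_mainTerm_div`).
-/

namespace DimFreeWaring

/-! ### Gauss sums -/

/-- The normalized one-dimensional quadratic Gauss sum
`q⁻¹ ∑_{n mod q} e^{2πi (p n² + x n) / q}`, for any integer numerator `p`. -/
noncomputable def gaussOne (p : ℤ) (q : ℕ) (x : ℤ) : ℂ :=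
  (q : ℂ)⁻¹ * ∑ n ∈ Finset.range q,
    Complex.exp (2 * Real.pi * Complex.I * (((n : ℤ) ^ 2 * p + x * n : ℤ) : ℂ) / q)

theorem sum_range_eq_sum_zmod {M : Type*} [AddCommMonoid M] (q : ℕ) [NeZero q] (f : ZMod q → M) :
    ∑ n ∈ Finset.range q, f (n : ZMod q) = ∑ a : ZMod q, f a := by
  refine Finset.sum_nbij' (fun n => (n : ZMod q)) ZMod.val ?_ ?_ ?_ ?_ ?_
  · simp
  · intro a _
    simpa using ZMod.val_lt a
  · intro n hn
    exact ZMod.val_cast_of_lt (by simpa using hn)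
  · intro a _
    simp
  · simp

theorem gaussOne_eq_sum_zmod (p : ℤ) (q : ℕ) [NeZero q] (x : ℤ) :
    gaussOne p q x = (q : ℂ)⁻¹ * ∑ a : ZMod q,
      ZMod.stdAddChar ((p : ZMod q) * a ^ 2 + (x : ZMod q) * a) := by
  rw [gaussOne, ← sum_range_eq_sum_zmod q]
  congr 1
  refine Finset.sum_congr rfl fun n _ => ?_
  rw [← ZMod.stdAddChar_coe]
  congr 1
  push_cast
  ring

/-- Weyl differencing: expanding the square, the inner sum vanishes unless `2 h = 0`, which has at
most two solutions modulo `q`. -/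
theorem normSq_sum_stdAddChar_le (q : ℕ) [NeZero q] (p x : ZMod q) (hp : IsUnit p) :
    ‖∑ a : ZMod q, ZMod.stdAddChar (p * a ^ 2 + x * a)‖ ^ 2 ≤ 2 * (q : ℝ) := by
  set e := ZMod.stdAddChar (N := q) with he
  set S := ∑ a : ZMod q, e (p * a ^ 2 + x * a) with hS
  have key : (S * (starRingEnd ℂ) S) =
      ∑ h : ZMod q, e (p * h ^ 2 + x * h) * ∑ m : ZMod q, e (m * (2 * p * h)) := by
    rw [hS, map_sum, Finset.sum_mul_sum, Finset.sum_comm]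
    simp_rw [Finset.mul_sum]
    conv_rhs => rw [Finset.sum_comm]
    refine Finset.sum_congr rfl fun m _ => ?_
    -- substitute `h + m` for the variable of the outer factor
    rw [← Equiv.sum_comp (Equiv.addRight m)]
    refine Finset.sum_congr rfl fun h _ => ?_
    rw [← AddChar.map_neg_eq_conj, ← AddChar.map_add_eq_mul, ← AddChar.map_add_eq_mul]
    congr 1
    simp only [Equiv.coe_addRight]
    ring
  have hprim : e.IsPrimitive := ZMod.isPrimitive_stdAddChar q
  have hn : ‖S‖ ^ 2 = ‖S * (starRingEnd ℂ) S‖ := by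
    rw [norm_mul, RCLike.norm_conj, sq]
  rw [hn, key]
  have hin : ∀ h : ZMod q, ‖e (p * h ^ 2 + x * h) * ∑ m : ZMod q, e (m * (2 * p * h))‖ ≤
      if (2 : ℕ) • h = 0 then (q : ℝ) else 0 := by
    intro h
    rw [norm_mul, AddChar.norm_apply, one_mul, AddChar.sum_mulShift _ hprim]
    have : 2 * p * h = 0 ↔ (2 : ℕ) • h = 0 := by
      rw [two_nsmul, ← two_mul, mul_comm 2 p, mul_assoc, hp.mul_right_eq_zero]
    by_cases h2 : (2 : ℕ) • h = 0
    · rw [if_pos (this.2 h2), if_pos h2]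
      simp [ZMod.card]
    · rw [if_neg (fun h3 => h2 (this.1 h3)), if_neg h2]
      simp
  refine (norm_sum_le _ _).trans ((Finset.sum_le_sum fun h _ => hin h).trans ?_)
  rw [← Finset.sum_filter, Finset.sum_const, nsmul_eq_mul]
  have hc := IsAddCyclic.card_nsmul_eq_zero_le (α := ZMod q) (n := 2) (by norm_num)
  gcongr
  exact_mod_cast hc

theorem norm_gaussOne_le (p : ℤ) (q : ℕ) (hq : 0 < q) (hp : IsCoprime p (q : ℤ)) (x : ℤ) :
    ‖gaussOne p q x‖ ≤ √2 * (q : ℝ) ^ (-(1 / 2) : ℝ) := by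
  have : NeZero q := ⟨hq.ne'⟩
  have hq' : (0 : ℝ) < q := by exact_mod_cast hq
  rw [gaussOne_eq_sum_zmod, norm_mul, norm_inv, Complex.norm_natCast]
  have hu : IsUnit (p : ZMod q) := by
    obtain ⟨u, v, huv⟩ := hp
    refine IsUnit.of_mul_eq_one (u : ZMod q) ?_
    have := congrArg (Int.cast : ℤ → ZMod q) huv
    push_cast at this
    simp only [CharP.cast_eq_zero, mul_zero, add_zero] at this
    rw [mul_comm]; exact this
  have h := normSq_sum_stdAddChar_le q (p : ZMod q) x hu
  have h1 := Real.le_sqrt_of_sq_le h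
  rw [Real.sqrt_mul (by norm_num)] at h1
  rw [inv_mul_le_iff₀ hq']
  refine h1.trans (le_of_eq ?_)
  have : √(q : ℝ) = (q : ℝ) * (q : ℝ) ^ (-(1 / 2) : ℝ) := by
    nth_rewrite 2 [← Real.rpow_one (q : ℝ)]
    rw [← Real.rpow_add hq', Real.sqrt_eq_rpow]
    norm_num
  rw [this]; ring

theorem gaussG_eq_prod (d p q : ℕ) (hq : 0 < q) (x : Fin d → ℤ) :
    gaussG d p q x = ∏ i, gaussOne p q (x i) := by
  have hq' : (q : ℂ) ≠ 0 := by exact_mod_cast hq.ne'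
  have h1 : ∀ y : ℤ, gaussOne p q y = (q : ℂ)⁻¹ * ∑ n ∈ Finset.Icc 1 q,
      Complex.exp (2 * Real.pi * Complex.I * (((n : ℤ) ^ 2 * p + y * n : ℤ) : ℂ) / q) := by
    intro y
    rw [gaussOne]
    congr 1
    -- by periodicity the ranges `{0, …, q - 1}` and `{1, …, q}` give the same sum
    set f : ℕ → ℂ := fun n =>
      Complex.exp (2 * Real.pi * Complex.I * (((n : ℤ) ^ 2 * p + y * n : ℤ) : ℂ) / q) with hf
    have h0 : f q = f 0 := by
      simp only [hf]
      have : 2 * Real.pi * Complex.I * ((((q : ℕ) : ℤ) ^ 2 * p + y * q : ℤ) : ℂ) / q =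
        ((q * p + y : ℤ) : ℂ) * (2 * Real.pi * Complex.I) := by
        push_cast
        field_simp
      rw [this, Complex.exp_int_mul_two_pi_mul_I]
      simp
    change ∑ n ∈ Finset.range q, f n = ∑ n ∈ Finset.Icc 1 q, f n
    have e1 : ∑ n ∈ Finset.Icc 1 q, f n = ∑ n ∈ Finset.range q, f (n + 1) := by
      rw [Finset.range_eq_Ico, Finset.sum_Ico_add']
      rfl
    have e2 := Finset.sum_range_succ f q
    have e3 := Finset.sum_range_succ' f q
    rw [e1]
    rw [e2, h0] at e3
    exact add_right_cancel e3
  simp_rw [h1]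
  rw [Finset.prod_mul_distrib, Finset.prod_const, Finset.card_univ, Fintype.card_fin, gaussG,
    inv_pow, Finset.prod_univ_sum]
  congr 1
  refine Finset.sum_congr rfl fun n _ => ?_
  rw [← Complex.exp_sum]
  congr 1
  push_cast
  simp_rw [mul_div_assoc]
  rw [← Finset.mul_sum]
  congr 1
  simp_rw [add_div]
  rw [Finset.sum_add_distrib, Finset.sum_mul, ← Finset.sum_div, Finset.sum_div, Finset.sum_div]
  simp [mul_div_assoc]

theorem norm_gaussG_le (d p q : ℕ) (hq : 0 < q) (hp : Nat.Coprime p q) (x : Fin d → ℤ) :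
    ‖gaussG d p q x‖ ≤ (√2 * (q : ℝ) ^ (-(1 / 2) : ℝ)) ^ d := by
  rw [gaussG_eq_prod d p q hq, norm_prod]
  calc _ ≤ ∏ _i : Fin d, (√2 * (q : ℝ) ^ (-(1 / 2) : ℝ)) :=
        Finset.prod_le_prod (fun _ _ => norm_nonneg _)
          fun i _ => norm_gaussOne_le p q hq (Nat.isCoprime_iff_coprime.2 hp) (x i)
    _ = _ := by simp

/-! ### Theta functions near a rational point -/

/-- The parameter `2 (ε - iτ)` of the Gaussian `e^{-2π(ε - iτ) t²} = e^{-π a t²}`. -/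
noncomputable def arcParam (ε τ : ℝ) : ℂ := 2 * ((ε : ℂ) - τ * Complex.I)

theorem arcParam_re (ε τ : ℝ) : (arcParam ε τ).re = 2 * ε := by
  simp [arcParam]

theorem arcParam_im (ε τ : ℝ) : (arcParam ε τ).im = -2 * τ := by
  simp [arcParam]

theorem arcParam_ne_zero {ε : ℝ} (hε : 0 < ε) (τ : ℝ) : arcParam ε τ ≠ 0 := by
  intro h
  have := arcParam_re ε τ
  rw [h] at this
  simp at this
  linarith

theorem arcParam_add (ε s τ : ℝ) : arcParam ε (s + τ) = arcParam ε τ - 2 * s * Complex.I := by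
  simp only [arcParam]; push_cast; ring

theorem summable_exp_neg_quadratic {a : ℂ} (ha : 0 < a.re) (b : ℂ) :
    Summable fun n : ℤ => Complex.exp (-Real.pi * a * n ^ 2 + 2 * Real.pi * b * n) := by
  have h := (summable_jacobiTheta₂_term_iff (-Complex.I * b) (Complex.I * a)).2 (by simpa using ha)
  refine h.congr fun n => ?_
  rw [jacobiTheta₂_term]
  congr 1
  linear_combination (-(2 * Real.pi * n * b) + Real.pi * n ^ 2 * a) * Complex.I_sq

theorem ofReal_mul_cpow {r : ℝ} (hr : 0 < r) {z : ℂ} (hz : z ≠ 0) (s : ℂ) :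
    ((r : ℂ) * z) ^ s = (r : ℂ) ^ s * z ^ s := by
  have hr' : (r : ℂ) ≠ 0 := by exact_mod_cast hr.ne'
  rw [Complex.cpow_def_of_ne_zero (mul_ne_zero hr' hz), Complex.cpow_def_of_ne_zero hr',
    Complex.cpow_def_of_ne_zero hz, Complex.log_ofReal_mul hr hz, add_mul, Complex.exp_add,
    Complex.ofReal_log hr.le]

theorem norm_arcParam_cpow_half (ε τ : ℝ) :
    ‖arcParam ε τ ^ (1 / 2 : ℂ)‖ = ‖arcParam ε τ‖ ^ (1 / 2 : ℝ) := by
  rw [← Complex.norm_cpow_real]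
  norm_num

/-- The regularized exponential sum `∑ₘ e^{2πi (α + iε) m² + 2πi m ξ}` over the integers. -/
noncomputable def theta (ε α ξ : ℝ) : ℂ :=
  ∑' m : ℤ, Complex.exp (-Real.pi * arcParam ε α * m ^ 2 + 2 * Real.pi * (Complex.I * ξ) * m)

/-- The term of index `x` in the expansion of `theta ε (p / q + τ) ξ` about the fraction `p / q`. -/
noncomputable def thetaTerm (ε τ ξ : ℝ) (p : ℤ) (q : ℕ) (x : ℤ) : ℂ :=
  gaussOne p q x * (arcParam ε τ ^ (1 / 2 : ℂ))⁻¹ *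
    Complex.exp (-Real.pi * (((x : ℝ) / q - ξ : ℝ) : ℂ) ^ 2 / arcParam ε τ)

/-- On the residue class `r` modulo `q` the phase `e^{2πi p m² / q}` is constant, so a summand of the
theta series factors into a constant and a Gaussian in the quotient `k`. -/
theorem theta_summand_residue (ε τ ξ : ℝ) (p : ℤ) (q : ℕ) (hq : 0 < q) (k : ℤ) (r : ℕ) :
    Complex.exp (-Real.pi * arcParam ε ((p : ℝ) / q + τ) * ((k * q + r : ℤ) : ℂ) ^ 2 +
      2 * Real.pi * (Complex.I * ξ) * ((k * q + r : ℤ) : ℂ)) =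
    Complex.exp (2 * Real.pi * Complex.I * p * r ^ 2 / q - Real.pi * arcParam ε τ * r ^ 2 +
      2 * Real.pi * Complex.I * ξ * r) *
    Complex.exp (-Real.pi * ((q : ℂ) ^ 2 * arcParam ε τ) * k ^ 2 +
      2 * Real.pi * (-(arcParam ε τ * r * q) + Complex.I * q * ξ) * k) := by
  have hq' : (q : ℂ) ≠ 0 := by exact_mod_cast hq.ne'
  rw [← Complex.exp_add, arcParam_add, Complex.exp_eq_exp_iff_exists_int]
  refine ⟨p * (k ^ 2 * q + 2 * k * r), ?_⟩
  push_cast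
  field_simp
  ring

theorem tsum_residue (ε τ ξ : ℝ) (hε : 0 < ε) (p : ℤ) (q : ℕ) (hq : 0 < q) (r : ℕ) :
    ∑' k : ℤ, Complex.exp (-Real.pi * arcParam ε ((p : ℝ) / q + τ) * ((k * q + r : ℤ) : ℂ) ^ 2 +
      2 * Real.pi * (Complex.I * ξ) * ((k * q + r : ℤ) : ℂ)) =
    ∑' x : ℤ, (q : ℂ)⁻¹ *
      Complex.exp (2 * Real.pi * Complex.I * (((r : ℤ) ^ 2 * p + x * r : ℤ) : ℂ) / q) *
      (arcParam ε τ ^ (1 / 2 : ℂ))⁻¹ *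
      Complex.exp (-Real.pi * (((x : ℝ) / q - ξ : ℝ) : ℂ) ^ 2 / arcParam ε τ) := by
  have hq' : (q : ℂ) ≠ 0 := by exact_mod_cast hq.ne'
  have hqr : (0 : ℝ) < q := by exact_mod_cast hq
  have ha0 := arcParam_ne_zero hε τ
  have hre : 0 < ((q : ℂ) ^ 2 * arcParam ε τ).re := by
    have : (q : ℂ) ^ 2 * arcParam ε τ = (((q : ℝ) ^ 2 : ℝ) : ℂ) * arcParam ε τ := by push_cast; ring
    rw [this, Complex.re_ofReal_mul, arcParam_re]
    positivity
  have hsq : ((q : ℂ) ^ 2 * arcParam ε τ) ^ (1 / 2 : ℂ) = q * arcParam ε τ ^ (1 / 2 : ℂ) := by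
    have : (q : ℂ) ^ 2 * arcParam ε τ = (((q : ℝ) ^ 2 : ℝ) : ℂ) * arcParam ε τ := by push_cast; ring
    rw [this, ofReal_mul_cpow (by positivity) ha0]
    have h2 : ((q : ℝ) ^ 2) ^ (1 / 2 : ℝ) = q := by
      rw [← Real.sqrt_eq_rpow, Real.sqrt_sq hqr.le]
    have h3 : (((q : ℝ) ^ 2 : ℝ) : ℂ) ^ (1 / 2 : ℂ) = ((((q : ℝ) ^ 2) ^ (1 / 2 : ℝ) : ℝ) : ℂ) := by
      rw [Complex.ofReal_cpow (by positivity)]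
      norm_num
    rw [h3, h2]
    simp
  simp_rw [theta_summand_residue ε τ ξ p q hq]
  rw [tsum_mul_left, Complex.tsum_exp_neg_quadratic hre, hsq, ← mul_assoc, ← tsum_mul_left]
  refine tsum_congr fun x => ?_
  rw [one_div, mul_inv]
  have hexp : Complex.exp (2 * Real.pi * Complex.I * p * r ^ 2 / q -
        Real.pi * arcParam ε τ * r ^ 2 + 2 * Real.pi * Complex.I * ξ * r) *
      Complex.exp (-Real.pi / ((q : ℂ) ^ 2 * arcParam ε τ) *
        (x + Complex.I * (-(arcParam ε τ * r * q) + Complex.I * q * ξ)) ^ 2) =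
      Complex.exp (2 * Real.pi * Complex.I * (((r : ℤ) ^ 2 * p + x * r : ℤ) : ℂ) / q) *
      Complex.exp (-Real.pi * (((x : ℝ) / q - ξ : ℝ) : ℂ) ^ 2 / arcParam ε τ) := by
    rw [← Complex.exp_add, ← Complex.exp_add]
    congr 1
    set A := arcParam ε τ with hA
    have hI : (x + Complex.I * (-(A * r * q) + Complex.I * q * ξ)) =
        (x - q * ξ - Complex.I * (A * r * q) : ℂ) := by
      linear_combination (q * ξ : ℂ) * Complex.I_sq
    rw [hI]
    push_cast
    field_simp
    linear_combination (-(q : ℂ) ^ 2 * A ^ 2 * r ^ 2) * Complex.I_sq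
  calc _ = (q : ℂ)⁻¹ * (arcParam ε τ ^ (1 / 2 : ℂ))⁻¹ *
      (Complex.exp (2 * Real.pi * Complex.I * p * r ^ 2 / q -
        Real.pi * arcParam ε τ * r ^ 2 + 2 * Real.pi * Complex.I * ξ * r) *
      Complex.exp (-Real.pi / ((q : ℂ) ^ 2 * arcParam ε τ) *
        (x + Complex.I * (-(arcParam ε τ * r * q) + Complex.I * q * ξ)) ^ 2)) := by ring
    _ = _ := by rw [hexp]; ring

theorem summable_mul_exp_neg_sq_div (ε τ ξ : ℝ) (hε : 0 < ε) (q : ℕ) (hq : 0 < q) (c : ℤ → ℂ)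
    (b : ℝ) (hc : ∀ x, ‖c x‖ ≤ b) :
    Summable fun x : ℤ => c x *
      Complex.exp (-Real.pi * (((x : ℝ) / q - ξ : ℝ) : ℂ) ^ 2 / arcParam ε τ) := by
  have hq' : (q : ℂ) ≠ 0 := by exact_mod_cast hq.ne'
  have ha0 := arcParam_ne_zero hε τ
  have hre : 0 < (((q : ℂ) ^ 2 * arcParam ε τ)⁻¹).re := by
    have : ((q : ℂ) ^ 2 * arcParam ε τ)⁻¹ =
        ((((q : ℝ) ^ 2)⁻¹ : ℝ) : ℂ) * (arcParam ε τ)⁻¹ := by push_cast; rw [mul_inv]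
    rw [this, Complex.re_ofReal_mul, Complex.inv_re, arcParam_re]
    have := Complex.normSq_pos.2 ha0
    positivity
  have hs := summable_exp_neg_quadratic hre (ξ / (arcParam ε τ * q))
  have hs2 := (hs.mul_left (Complex.exp (-Real.pi * ξ ^ 2 / arcParam ε τ))).norm.mul_left b
  refine Summable.of_norm_bounded hs2 fun x => ?_
  rw [norm_mul]
  refine mul_le_mul (hc x) (le_of_eq ?_) (norm_nonneg _) ((norm_nonneg _).trans (hc x))
  rw [← Complex.exp_add]
  congr 2
  push_cast
  field_simp
  ring

/-- Poisson summation (the functional equation of the theta function) in each residue class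
modulo `q` turns the sum over the integers into a sum weighted by Gauss sums. -/
theorem theta_eq_tsum_thetaTerm (ε τ ξ : ℝ) (hε : 0 < ε) (p : ℤ) (q : ℕ) (hq : 0 < q) :
    Summable (thetaTerm ε τ ξ p q) ∧
    theta ε ((p : ℝ) / q + τ) ξ = ∑' x : ℤ, thetaTerm ε τ ξ p q x := by
  have : NeZero q := ⟨hq.ne'⟩
  set f : ℕ → ℤ → ℂ := fun r x => (q : ℂ)⁻¹ *
      Complex.exp (2 * Real.pi * Complex.I * (((r : ℤ) ^ 2 * p + x * r : ℤ) : ℂ) / q) *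
      (arcParam ε τ ^ (1 / 2 : ℂ))⁻¹ *
      Complex.exp (-Real.pi * (((x : ℝ) / q - ξ : ℝ) : ℂ) ^ 2 / arcParam ε τ) with hf
  have hfs : ∀ r, Summable (f r) := by
    intro r
    refine summable_mul_exp_neg_sq_div ε τ ξ hε q hq _
      (‖(q : ℂ)⁻¹‖ * ‖(arcParam ε τ ^ (1 / 2 : ℂ))⁻¹‖) fun x => ?_
    rw [norm_mul, norm_mul]
    have : ‖Complex.exp (2 * Real.pi * Complex.I *
        (((r : ℤ) ^ 2 * p + x * r : ℤ) : ℂ) / q)‖ = 1 := by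
      have h : 2 * Real.pi * Complex.I * (((r : ℤ) ^ 2 * p + x * r : ℤ) : ℂ) / q =
        ((2 * Real.pi * ((r : ℤ) ^ 2 * p + x * r : ℤ) / q : ℝ) : ℂ) * Complex.I := by
        push_cast; ring
      rw [h, Complex.norm_exp_ofReal_mul_I]
    rw [this, mul_one]
  have hterm : ∀ x, thetaTerm ε τ ξ p q x = ∑ r ∈ Finset.range q, f r x := by
    intro x
    simp only [thetaTerm, gaussOne, hf, Finset.mul_sum, Finset.sum_mul]
  refine ⟨(summable_sum fun r _ => hfs r).congr fun x => (hterm x).symm, ?_⟩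
  simp_rw [hterm]
  rw [Summable.tsum_finsetSum fun r _ => hfs r]
  have hsum := summable_exp_neg_quadratic (a := arcParam ε ((p : ℝ) / q + τ))
    (by rw [arcParam_re]; positivity) (Complex.I * ξ)
  rw [theta]
  refine (((Equiv.prodComm (Fin q) ℤ).trans (Int.divModEquiv q).symm).tsum_eq _).symm.trans ?_
  refine (Summable.tsum_prod
    (((Equiv.prodComm (Fin q) ℤ).trans (Int.divModEquiv q).symm).summable_iff.2 hsum)).trans ?_
  rw [tsum_fintype, Finset.sum_range]
  refine Finset.sum_congr rfl fun r _ => ?_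
  rw [← tsum_residue ε τ ξ hε p q hq r]
  refine tsum_congr fun k => ?_
  simp [Int.divModEquiv_symm_apply]

/-! ### Bounds on a single arc -/

/-- The rate of Gaussian decay of `thetaTerm ε τ ξ p q x` in the variable `x - q ξ`. -/
noncomputable def arcRate (ε τ : ℝ) (q : ℕ) : ℝ := 2 * ε / ((q : ℝ) ^ 2 * ‖arcParam ε τ‖ ^ 2)

theorem norm_arcParam_sq (ε τ : ℝ) : ‖arcParam ε τ‖ ^ 2 = 4 * ε ^ 2 + 4 * τ ^ 2 := by
  rw [← Complex.normSq_eq_norm_sq, Complex.normSq_apply, arcParam_re, arcParam_im]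
  ring

theorem arcRate_pos {ε : ℝ} (hε : 0 < ε) (τ : ℝ) {q : ℕ} (hq : 0 < q) : 0 < arcRate ε τ q := by
  have hq' : (0 : ℝ) < q := by exact_mod_cast hq
  have := norm_pos_iff.2 (arcParam_ne_zero hε τ)
  rw [arcRate]
  positivity

theorem norm_thetaTerm_le {ε : ℝ} (hε : 0 < ε) (τ ξ : ℝ) {p : ℤ} {q : ℕ} (hq : 0 < q)
    (hp : IsCoprime p (q : ℤ)) (x : ℤ) :
    ‖thetaTerm ε τ ξ p q x‖ ≤ √2 * (arcRate ε τ q / (2 * ε)) ^ (1 / 4 : ℝ) *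
      Real.exp (-(Real.pi * arcRate ε τ q * (x - q * ξ) ^ 2)) := by
  have hq' : (0 : ℝ) < q := by exact_mod_cast hq
  have ha := norm_pos_iff.2 (arcParam_ne_zero hε τ)
  rw [thetaTerm, norm_mul, norm_mul]
  have h1 : (arcRate ε τ q / (2 * ε)) ^ (1 / 4 : ℝ) =
      (q : ℝ) ^ (-(1 / 2) : ℝ) * ‖(arcParam ε τ ^ (1 / 2 : ℂ))⁻¹‖ := by
    rw [norm_inv, norm_arcParam_cpow_half, ← Real.rpow_neg ha.le, ← Real.mul_rpow hq'.le ha.le]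
    have e2 : arcRate ε τ q / (2 * ε) = ((q : ℝ) * ‖arcParam ε τ‖) ^ (-2 : ℝ) := by
      rw [Real.rpow_neg (by positivity), arcRate]
      norm_cast
      push_cast
      field_simp
    rw [e2, ← Real.rpow_mul (by positivity)]
    norm_num
  have h2 : ‖Complex.exp (-Real.pi * (((x : ℝ) / q - ξ : ℝ) : ℂ) ^ 2 / arcParam ε τ)‖ =
      Real.exp (-(Real.pi * arcRate ε τ q * (x - q * ξ) ^ 2)) := by
    rw [Complex.norm_exp]
    congr 1
    have : -(Real.pi : ℂ) * (((x : ℝ) / q - ξ : ℝ) : ℂ) ^ 2 / arcParam ε τ =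
        ((-Real.pi * ((x : ℝ) / q - ξ) ^ 2 : ℝ) : ℂ) * (arcParam ε τ)⁻¹ := by
      push_cast; rw [div_eq_mul_inv]
    rw [this, Complex.re_ofReal_mul, Complex.inv_re, arcParam_re, Complex.normSq_eq_norm_sq, arcRate]
    field_simp
  rw [h2, h1, ← mul_assoc]
  gcongr
  exact norm_gaussOne_le p q hq hp x

theorem summable_exp_neg_abs_int {c : ℝ} (hc : 0 < c) :
    Summable fun k : ℤ => Real.exp (-(c * (|(k : ℝ)| - 1))) := by
  have h : Summable fun n : ℕ => Real.exp (-(c * ((n : ℝ) - 1))) := by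
    have := (Real.summable_exp_nat_mul_iff.2 (neg_lt_zero.2 hc)).mul_left (Real.exp c)
    refine this.congr fun n => ?_
    rw [← Real.exp_add]; congr 1; ring
  refine Summable.of_nat_of_neg ?_ ?_
  · simpa using h
  · simpa using h

/-- An absolute constant bounding the contribution of all integers but the nearest one to a
theta series. -/
noncomputable def tailConst : ℝ := ∑' k : ℤ, Real.exp (-(Real.pi / 16 * (|(k : ℝ)| - 1)))

theorem tailConst_nonneg : 0 ≤ tailConst := tsum_nonneg fun _ => (Real.exp_pos _).le

theorem norm_thetaTerm_round_le {ε : ℝ} (hε : 0 < ε) (τ ξ : ℝ) {p : ℤ} {q : ℕ} (hq : 0 < q)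
    (hp : IsCoprime p (q : ℤ)) :
    ‖thetaTerm ε τ ξ p q (round (q * ξ))‖ ≤ √2 * (arcRate ε τ q / (2 * ε)) ^ (1 / 4 : ℝ) := by
  refine (norm_thetaTerm_le hε τ ξ hq hp _).trans ?_
  have := arcRate_pos hε τ hq
  refine mul_le_of_le_one_right (by positivity) ?_
  rw [Real.exp_le_one_iff, neg_nonpos]
  positivity

/-- A theta function is its term at the nearest integer up to a Gaussian small error: the other
integers are at distance at least `1 / 2` from `q ξ`. -/
theorem norm_theta_sub_thetaTerm_le {ε : ℝ} (hε : 0 < ε) (τ ξ : ℝ) {p : ℤ} {q : ℕ} (hq : 0 < q)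
    (hp : IsCoprime p (q : ℤ)) (hv : 1 / 4 ≤ arcRate ε τ q) :
    ‖theta ε ((p : ℝ) / q + τ) ξ - thetaTerm ε τ ξ p q (round (q * ξ))‖ ≤
      √2 * (arcRate ε τ q / (2 * ε)) ^ (1 / 4 : ℝ) *
        (tailConst * Real.exp (-(Real.pi * arcRate ε τ q / 4))) := by
  obtain ⟨hs, he⟩ := theta_eq_tsum_thetaTerm ε τ ξ hε p q hq
  rw [he, hs.tsum_eq_add_tsum_ite (round (q * ξ)), add_sub_cancel_left]
  set v := arcRate ε τ q with hvdef
  set x0 := round (q * ξ) with hx0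
  set B := √2 * (v / (2 * ε)) ^ (1 / 4 : ℝ) with hB
  have hB0 : 0 ≤ B := by positivity
  have hsum : HasSum (fun x : ℤ => B * Real.exp (-(Real.pi * v / 4)) *
      Real.exp (-(Real.pi / 16 * (|((x - x0 : ℤ) : ℝ)| - 1))))
      (B * Real.exp (-(Real.pi * v / 4)) * tailConst) := by
    refine HasSum.mul_left _ ?_
    have h := (summable_exp_neg_abs_int (c := Real.pi / 16) (by positivity)).hasSum
    exact (Equiv.subRight x0).hasSum_iff.2 h
  refine (tsum_of_norm_bounded hsum fun x => ?_).trans (le_of_eq (by ring))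
  split_ifs with hx
  · rw [norm_zero]; positivity
  · refine (norm_thetaTerm_le hε τ ξ hq hp x).trans ?_
    rw [mul_assoc B, ← Real.exp_add]
    refine mul_le_mul_of_nonneg_left (Real.exp_le_exp.2 ?_) hB0
    -- with `k = |x - x0| ≥ 1` the distance from `x` to `q ξ` is at least `k / 2`, and `k² ≥ k`
    have hk : (1 : ℝ) ≤ |((x - x0 : ℤ) : ℝ)| := by
      rw [← Int.cast_abs]
      exact_mod_cast Int.one_le_abs (sub_ne_zero.2 hx)
    have hd : |q * ξ - x0| ≤ 1 / 2 := abs_sub_round (q * ξ)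
    set k : ℝ := |((x - x0 : ℤ) : ℝ)| with hkdef
    have h1 : k ≤ |(x : ℝ) - q * ξ| + |q * ξ - x0| := by
      rw [hkdef]; push_cast
      exact abs_sub_le _ _ _
    have h2 : k / 2 ≤ |(x : ℝ) - q * ξ| := by linarith
    have h3 : k / 4 ≤ ((x : ℝ) - q * ξ) ^ 2 := by
      rw [← sq_abs]
      nlinarith
    have hpi := Real.pi_pos
    have h4 : Real.pi * v * (k / 4) ≤ Real.pi * v * ((x : ℝ) - q * ξ) ^ 2 := by gcongr
    have h5 : Real.pi * (1 / 4) * ((k - 1) / 4) ≤ Real.pi * v * ((k - 1) / 4) := by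
      gcongr
    linarith

theorem norm_prod_sub_prod_le {ι : Type*} (s : Finset ι) (f g : ι → ℂ) {M δ : ℝ} (hM : 0 ≤ M)
    (hf : ∀ i ∈ s, ‖f i‖ ≤ M) (hg : ∀ i ∈ s, ‖g i‖ ≤ M)
    (hfg : ∀ i ∈ s, ‖f i - g i‖ ≤ M * δ) :
    ‖∏ i ∈ s, f i - ∏ i ∈ s, g i‖ ≤ s.card * δ * M ^ s.card := by
  classical
  induction s using Finset.induction_on with
  | empty => simp
  | insert a s ha ih =>
    rw [Finset.prod_insert ha, Finset.prod_insert ha, Finset.card_insert_of_notMem ha]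
    have e : f a * ∏ i ∈ s, f i - g a * ∏ i ∈ s, g i =
        f a * (∏ i ∈ s, f i - ∏ i ∈ s, g i) + (f a - g a) * ∏ i ∈ s, g i := by ring
    rw [e]
    have h1 := ih (fun i hi => hf i (Finset.mem_insert_of_mem hi))
      (fun i hi => hg i (Finset.mem_insert_of_mem hi))
      (fun i hi => hfg i (Finset.mem_insert_of_mem hi))
    have h2 : ‖∏ i ∈ s, g i‖ ≤ M ^ s.card := by
      rw [norm_prod, ← Finset.prod_const]
      exact Finset.prod_le_prod (fun _ _ => norm_nonneg _)
        (fun i hi => hg i (Finset.mem_insert_of_mem hi))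
    have h3 := hf a (Finset.mem_insert_self _ _)
    have h4 := hfg a (Finset.mem_insert_self _ _)
    calc _ ≤ ‖f a‖ * ‖∏ i ∈ s, f i - ∏ i ∈ s, g i‖ + ‖f a - g a‖ * ‖∏ i ∈ s, g i‖ := by
          refine (norm_add_le _ _).trans ?_
          rw [norm_mul, norm_mul]
      _ ≤ M * (s.card * δ * M ^ s.card) + M * δ * M ^ s.card := by
          refine add_le_add (mul_le_mul h3 h1 (norm_nonneg _) hM)
            (mul_le_mul h4 h2 (norm_nonneg _) ((norm_nonneg _).trans h4))
      _ = _ := by push_cast; ring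

/-- The maximum of `v ↦ v ^ s e^{-c v}` is at most `(s / c) ^ s`. -/
theorem rpow_mul_exp_neg_le {v s c : ℝ} (hv : 0 < v) (hs : 0 < s) (hc : 0 < c) :
    v ^ s * Real.exp (-(c * v)) ≤ (s / c) ^ s := by
  have h1 : v * c / s ≤ Real.exp (v * c / s) := by
    linarith [Real.add_one_le_exp (v * c / s)]
  have h2 : (v * c / s) ^ s ≤ Real.exp (c * v) := by
    refine (Real.rpow_le_rpow (by positivity) h1 hs.le).trans (le_of_eq ?_)
    rw [← Real.exp_mul]
    congr 1
    field_simp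
  have h3 : v ^ s = (v * c / s) ^ s * (s / c) ^ s := by
    rw [← Real.mul_rpow (by positivity) (by positivity)]
    congr 1
    field_simp
  rw [h3, Real.exp_neg, mul_comm, ← mul_assoc, inv_mul_eq_div]
  refine mul_le_of_le_one_left (by positivity) ?_
  rw [div_le_one (Real.exp_pos _)]
  exact h2

/-- The absolute base of the exponential error bound on a single arc. -/
noncomputable def arcConst : ℝ := 6 * √2 * (1 + tailConst)

theorem arcConst_pos : 0 < arcConst := by
  have := tailConst_nonneg
  rw [arcConst]; positivity

theorem norm_theta_le {ε : ℝ} (hε : 0 < ε) (τ : ℝ) {d : ℕ} (ξ : Fin d → ℝ) {p : ℤ} {q : ℕ}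
    (hq : 0 < q) (hp : IsCoprime p (q : ℤ)) (hv : 1 / 4 ≤ arcRate ε τ q) :
    ∀ i, ‖theta ε ((p : ℝ) / q + τ) (ξ i)‖ ≤
      √2 * (1 + tailConst) * (arcRate ε τ q / (2 * ε)) ^ (1 / 4 : ℝ) := by
  intro i
  have h1 := norm_thetaTerm_round_le hε τ (ξ i) hq hp
  have h2 := norm_theta_sub_thetaTerm_le hε τ (ξ i) hq hp hv
  have h3 : ‖theta ε ((p : ℝ) / q + τ) (ξ i)‖ ≤
      ‖theta ε ((p : ℝ) / q + τ) (ξ i) - thetaTerm ε τ (ξ i) p q (round (q * ξ i))‖ +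
      ‖thetaTerm ε τ (ξ i) p q (round (q * ξ i))‖ := by
    simpa using norm_add_le
      (theta ε ((p : ℝ) / q + τ) (ξ i) - thetaTerm ε τ (ξ i) p q (round (q * ξ i)))
      (thetaTerm ε τ (ξ i) p q (round (q * ξ i)))
  have h4 : Real.exp (-(Real.pi * arcRate ε τ q / 4)) ≤ 1 := by
    rw [Real.exp_le_one_iff, neg_nonpos]
    have := arcRate_pos hε τ hq
    positivity
  have h5 : tailConst * Real.exp (-(Real.pi * arcRate ε τ q / 4)) ≤ tailConst :=
    mul_le_of_le_one_right tailConst_nonneg h4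
  have h0 : 0 ≤ √2 * (arcRate ε τ q / (2 * ε)) ^ (1 / 4 : ℝ) := by
    have := arcRate_pos hε τ hq
    positivity
  have h6 := mul_le_mul_of_nonneg_left h5 h0
  linarith

/-- A factor `v ^ (d / 4)`, coming from the
height of the `d` theta functions, is absorbed by a single Gaussian `e^{-c v}` at the cost of
`d ^ (d / 4)`. -/
theorem arc_pow_bound {L v : ℝ} (hL : 0 < L) (hv : 0 < v) {d : ℕ} (hd : 0 < d) :
    (d + 2) * (√2 * (1 + tailConst) * (v / (2 * (1 / L))) ^ (1 / 4 : ℝ)) ^ d *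
      Real.exp (-(Real.pi * v / 64)) ≤ arcConst ^ d * (d * L) ^ ((d : ℝ) / 4) := by
  have hd' : (0 : ℝ) < d := by exact_mod_cast hd
  have hC := tailConst_nonneg
  have h1 : ((d : ℝ) + 2) ≤ 3 ^ d := by
    have := one_add_mul_le_pow (a := (2 : ℝ)) (by norm_num) d
    have h1d : (1 : ℝ) ≤ d := by exact_mod_cast hd
    norm_num at this
    linarith
  have h2 : ((v / (2 * (1 / L))) ^ (1 / 4 : ℝ)) ^ d ≤ v ^ ((d : ℝ) / 4) * L ^ ((d : ℝ) / 4) := by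
    rw [← Real.rpow_natCast, ← Real.rpow_mul (by positivity), ← Real.mul_rpow hv.le hL.le]
    rw [show (1 / 4 : ℝ) * d = d / 4 by ring]
    refine Real.rpow_le_rpow (by positivity) ?_ (by positivity)
    rw [show v / (2 * (1 / L)) = v * L / 2 by field_simp]
    linarith [mul_pos hv hL]
  have h3 := rpow_mul_exp_neg_le hv (s := (d : ℝ) / 4) (c := Real.pi / 64) (by positivity)
    (by positivity)
  have h4 : ((d : ℝ) / 4 / (Real.pi / 64)) ^ ((d : ℝ) / 4) ≤ 2 ^ d * (d : ℝ) ^ ((d : ℝ) / 4) := by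
    have e : (2 : ℝ) ^ d = (16 : ℝ) ^ ((d : ℝ) / 4) := by
      rw [show (16 : ℝ) = 2 ^ (4 : ℝ) by norm_num, ← Real.rpow_mul (by norm_num)]
      rw [show (4 : ℝ) * (d / 4) = d by ring, Real.rpow_natCast]
    rw [e, ← Real.mul_rpow (by norm_num) hd'.le]
    refine Real.rpow_le_rpow (by positivity) ?_ (by positivity)
    have : (1 : ℝ) ≤ Real.pi := by linarith [Real.pi_gt_three]
    rw [div_div_eq_mul_div, div_le_iff₀ Real.pi_pos]
    nlinarith
  have h5 : v ^ ((d : ℝ) / 4) * Real.exp (-(Real.pi * v / 64)) ≤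
      2 ^ d * (d : ℝ) ^ ((d : ℝ) / 4) := by
    refine le_trans (le_of_eq ?_) (h3.trans h4)
    congr 3; ring
  rw [mul_pow]
  calc _ ≤ 3 ^ d * ((√2 * (1 + tailConst)) ^ d * (v ^ ((d : ℝ) / 4) * L ^ ((d : ℝ) / 4))) *
        Real.exp (-(Real.pi * v / 64)) := by gcongr
    _ = 3 ^ d * (√2 * (1 + tailConst)) ^ d * L ^ ((d : ℝ) / 4) *
        (v ^ ((d : ℝ) / 4) * Real.exp (-(Real.pi * v / 64))) := by ring
    _ ≤ 3 ^ d * (√2 * (1 + tailConst)) ^ d * L ^ ((d : ℝ) / 4) *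
        (2 ^ d * (d : ℝ) ^ ((d : ℝ) / 4)) := by gcongr
    _ = _ := by
        rw [Real.mul_rpow hd'.le hL.le, arcConst,
          show 6 * √2 * (1 + tailConst) = 3 * (√2 * (1 + tailConst)) * 2 by ring,
          mul_pow (3 * (√2 * (1 + tailConst))), mul_pow 3]
        ring

/-- Approximation on an arc. The weight `w` may differ from one only if some coordinate of `q ξ` is
at distance at least `1 / 8` from the integers; then the main term itself is as small as the
error. -/
theorem norm_prod_theta_sub_le {L : ℝ} (hL : 0 < L) (τ : ℝ) {d : ℕ} (hd : 0 < d) (ξ : Fin d → ℝ)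
    {p : ℤ} {q : ℕ} (hq : 0 < q) (hp : IsCoprime p (q : ℤ)) (hv : 1 / 4 ≤ arcRate (1 / L) τ q)
    (w : ℂ) (hw : ‖w‖ ≤ 1)
    (hw1 : (∀ i, |q * ξ i - round (q * ξ i)| ≤ 1 / 8) → w = 1) :
    ‖∏ i, theta (1 / L) ((p : ℝ) / q + τ) (ξ i) -
      w * ∏ i, thetaTerm (1 / L) τ (ξ i) p q (round (q * ξ i))‖ ≤
      arcConst ^ d * (d * L) ^ ((d : ℝ) / 4) := by
  have hε : 0 < 1 / L := by positivity
  have hv0 := arcRate_pos hε τ hq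
  have hC := tailConst_nonneg
  have hpi := Real.pi_pos
  refine le_trans ?_ (arc_pow_bound hL hv0 hd)
  have hth := norm_theta_le hε τ ξ hq hp hv
  have hte := fun i => norm_theta_sub_thetaTerm_le hε τ (ξ i) hq hp hv
  have htt := fun i => norm_thetaTerm_round_le hε τ (ξ i) hq hp
  set v := arcRate (1 / L) τ q with hvdef
  set R := (v / (2 * (1 / L))) ^ (1 / 4 : ℝ) with hR
  have hR0 : 0 ≤ R := by positivity
  set M := √2 * (1 + tailConst) * R with hMdef
  have hM0 : 0 ≤ M := by positivity
  have hRM : √2 * R ≤ M := by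
    rw [hMdef]
    have : 0 ≤ √2 * R * tailConst := by positivity
    linarith
  have htM := fun i => (htt i).trans hRM
  have hmono : Real.exp (-(Real.pi * v / 4)) ≤ Real.exp (-(Real.pi * v / 64)) := by
    apply Real.exp_le_exp.2
    have := mul_pos hpi hv0
    linarith
  have hmain : ‖∏ i, theta (1 / L) ((p : ℝ) / q + τ) (ξ i) -
      ∏ i, thetaTerm (1 / L) τ (ξ i) p q (round (q * ξ i))‖ ≤
      d * Real.exp (-(Real.pi * v / 64)) * M ^ d := by
    have := norm_prod_sub_prod_le Finset.univ (fun i => theta (1 / L) ((p : ℝ) / q + τ) (ξ i))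
      (fun i => thetaTerm (1 / L) τ (ξ i) p q (round (q * ξ i))) hM0 (fun i _ => hth i)
      (fun i _ => htM i) (δ := Real.exp (-(Real.pi * v / 64))) (fun i _ => by
        refine (hte i).trans ?_
        calc √2 * R * (tailConst * Real.exp (-(Real.pi * v / 4)))
            = (√2 * tailConst * R) * Real.exp (-(Real.pi * v / 4)) := by ring
          _ ≤ M * Real.exp (-(Real.pi * v / 64)) := by
            rw [hMdef]
            gcongr
            linarith)
    simpa using this
  by_cases hall : ∀ i, |q * ξ i - round (q * ξ i)| ≤ 1 / 8
  · rw [hw1 hall, one_mul]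
    refine hmain.trans ?_
    have : 0 ≤ 2 * M ^ d * Real.exp (-(Real.pi * v / 64)) := by positivity
    linarith
  · push Not at hall
    obtain ⟨j, hj⟩ := hall
    have hA : ‖∏ i, thetaTerm (1 / L) τ (ξ i) p q (round (q * ξ i))‖ ≤
        M ^ d * Real.exp (-(Real.pi * v / 64)) := by
      rw [norm_prod, ← Finset.mul_prod_erase _ _ (Finset.mem_univ j)]
      have h1 : ∏ i ∈ Finset.univ.erase j,
          ‖thetaTerm (1 / L) τ (ξ i) p q (round (q * ξ i))‖ ≤ M ^ (d - 1) := by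
        refine (Finset.prod_le_prod (fun _ _ => norm_nonneg _) (fun i _ => htM i)).trans ?_
        simp
      have h2 : ‖thetaTerm (1 / L) τ (ξ j) p q (round (q * ξ j))‖ ≤
          M * Real.exp (-(Real.pi * v / 64)) := by
        refine (norm_thetaTerm_le hε τ (ξ j) hq hp _).trans ?_
        refine mul_le_mul hRM (Real.exp_le_exp.2 ?_) (Real.exp_pos _).le hM0
        have h3 : (1 / 8 : ℝ) ^ 2 ≤ ((round (q * ξ j) : ℝ) - q * ξ j) ^ 2 := by
          rw [← sq_abs (_ - _), abs_sub_comm]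
          gcongr
        have h4 : Real.pi * v * (1 / 8) ^ 2 ≤
            Real.pi * v * ((round (q * ξ j) : ℝ) - q * ξ j) ^ 2 := by gcongr
        rw [← hvdef]
        linarith
      calc _ ≤ M * Real.exp (-(Real.pi * v / 64)) * M ^ (d - 1) := by
            refine mul_le_mul h2 h1 (by positivity) (by positivity)
        _ = _ := by
          rw [show M ^ d = M * M ^ (d - 1) by rw [← pow_succ', Nat.sub_add_cancel hd]]
          ring
    set T := ∏ i, theta (1 / L) ((p : ℝ) / q + τ) (ξ i)
    set A := ∏ i, thetaTerm (1 / L) τ (ξ i) p q (round (q * ξ i))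
    have e : T - w * A = (T - A) + (1 - w) * A := by ring
    have hw2 : ‖1 - w‖ ≤ 2 := by
      refine (norm_sub_le _ _).trans ?_
      rw [norm_one]; linarith
    rw [e]
    refine (norm_add_le _ _).trans ?_
    rw [norm_mul]
    have := mul_le_mul hw2 hA (norm_nonneg _) (by norm_num)
    linarith

/-- Away from the centre of an arc the whole generating function is small. -/
theorem norm_prod_theta_le_of_arcRate_le {L : ℝ} (hL : 0 < L) (τ : ℝ) {d : ℕ} (hd : 0 < d)
    (ξ : Fin d → ℝ) {p : ℤ} {q : ℕ} (hq : 0 < q) (hp : IsCoprime p (q : ℤ))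
    (hv : 1 / 4 ≤ arcRate (1 / L) τ q) (hv2 : arcRate (1 / L) τ q ≤ 2) :
    ‖∏ i, theta (1 / L) ((p : ℝ) / q + τ) (ξ i)‖ ≤ arcConst ^ d * (d * L) ^ ((d : ℝ) / 4) := by
  have hε : 0 < 1 / L := by positivity
  have hv0 := arcRate_pos hε τ hq
  have hC := tailConst_nonneg
  have hd' : (1 : ℝ) ≤ d := by exact_mod_cast hd
  have hth := norm_theta_le hε τ ξ hq hp hv
  rw [norm_prod]
  calc _ ≤ ∏ _i : Fin d, (√2 * (1 + tailConst) * L ^ (1 / 4 : ℝ)) := by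
        refine Finset.prod_le_prod (fun _ _ => norm_nonneg _) fun i _ => (hth i).trans ?_
        gcongr
        rw [show arcRate (1 / L) τ q / (2 * (1 / L)) = arcRate (1 / L) τ q / 2 * L by field_simp]
        refine mul_le_of_le_one_left hL.le (by linarith)
    _ = (√2 * (1 + tailConst)) ^ d * L ^ ((d : ℝ) / 4) := by
        simp only [Finset.prod_const, Finset.card_univ, Fintype.card_fin]
        rw [mul_pow, ← Real.rpow_natCast (L ^ _), ← Real.rpow_mul hL.le]
        congr 2; ring
    _ ≤ _ := by
        gcongr
        · have := arcConst_pos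
          positivity
        · rw [arcConst]
          have : 0 ≤ √2 * (1 + tailConst) := by positivity
          linarith
        · exact le_mul_of_one_le_left hL.le hd'

/-- Inside the range of Dirichlet's approximation theorem the decay rate is bounded below. -/
theorem one_fourth_le_arcRate {lam q : ℕ} (hlam : 0 < lam) (hq : 0 < q) (hqN : q ≤ Nat.sqrt lam)
    {τ : ℝ} (hτ : |τ| ≤ 1 / (((Nat.sqrt lam : ℝ) + 1) * q)) :
    1 / 4 ≤ arcRate (1 / (lam : ℝ)) τ q := by
  have hL : (0 : ℝ) < lam := by exact_mod_cast hlam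
  have hq' : (0 : ℝ) < q := by exact_mod_cast hq
  have hqL : (q : ℝ) ^ 2 ≤ lam := by
    have : q ^ 2 ≤ lam := Nat.le_sqrt'.1 hqN
    exact_mod_cast this
  have hN : (lam : ℝ) ≤ ((Nat.sqrt lam : ℝ) + 1) ^ 2 := by
    have := (Nat.lt_succ_sqrt' lam).le
    exact_mod_cast this
  have h1 : (q * |τ|) * ((Nat.sqrt lam : ℝ) + 1) ≤ 1 := by
    rw [le_div_iff₀ (by positivity)] at hτ
    linarith
  have h2 : (q : ℝ) ^ 2 * τ ^ 2 * lam ≤ 1 := by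
    calc (q : ℝ) ^ 2 * τ ^ 2 * lam ≤ (q : ℝ) ^ 2 * τ ^ 2 * ((Nat.sqrt lam : ℝ) + 1) ^ 2 := by gcongr
      _ = ((q * |τ|) * ((Nat.sqrt lam : ℝ) + 1)) ^ 2 := by rw [mul_pow, mul_pow, sq_abs]
      _ ≤ 1 := pow_le_one₀ (by positivity) h1
  rw [arcRate, norm_arcParam_sq, div_le_div_iff₀ (by norm_num) (by positivity)]
  have h3 : (q : ℝ) ^ 2 * (1 / lam) ^ 2 ≤ 1 / lam := by
    rw [div_pow, one_pow, mul_one_div, div_le_div_iff₀ (by positivity) hL]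
    nlinarith
  have h4 : (q : ℝ) ^ 2 * τ ^ 2 ≤ 1 / lam := by
    rw [le_div_iff₀ hL]; exact h2
  linarith

/-- At distance at least `1 / (2 q N)` from the centre the decay rate is bounded above. -/
theorem arcRate_le_two {lam q : ℕ} (hlam : 0 < lam) (hq : 0 < q)
    {τ : ℝ} (hτ : 1 / (2 * q * (Nat.sqrt lam : ℝ)) ≤ |τ|) :
    arcRate (1 / (lam : ℝ)) τ q ≤ 2 := by
  have hL : (0 : ℝ) < lam := by exact_mod_cast hlam
  have hq' : (0 : ℝ) < q := by exact_mod_cast hq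
  have hN0 : (0 : ℝ) < Nat.sqrt lam := by exact_mod_cast Nat.sqrt_pos.2 hlam
  have hN : (Nat.sqrt lam : ℝ) ^ 2 ≤ lam := by
    have := Nat.sqrt_le' lam
    exact_mod_cast this
  have h1 : 1 ≤ 2 * (q * |τ|) * (Nat.sqrt lam : ℝ) := by
    rw [div_le_iff₀ (by positivity)] at hτ
    linarith
  have h2 : 1 ≤ 4 * ((q : ℝ) ^ 2 * τ ^ 2) * lam := by
    calc (1 : ℝ) ≤ (2 * (q * |τ|) * (Nat.sqrt lam : ℝ)) ^ 2 := one_le_pow₀ h1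
      _ = 4 * ((q : ℝ) ^ 2 * τ ^ 2) * (Nat.sqrt lam : ℝ) ^ 2 := by
        rw [mul_pow, mul_pow, mul_pow, sq_abs]; ring
      _ ≤ _ := by gcongr
  have h3 : 1 / (lam : ℝ) ≤ 4 * ((q : ℝ) ^ 2 * τ ^ 2) := by
    rw [div_le_iff₀ hL]; exact h2
  rw [arcRate, norm_arcParam_sq, div_le_iff₀ (by positivity)]
  have h4 : 0 ≤ (q : ℝ) ^ 2 * (1 / lam) ^ 2 := by positivity
  linarith

/-! ### The singular integral and the surface measure -/

/-- Integration in polar coordinates for an arbitrary integrable function. -/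
theorem integral_polar {d : ℕ} (hd : 0 < d) (f : EuclideanSpace ℝ (Fin d) → ℂ)
    (hf : Integrable f) :
    ∫ x, f x = ∫ r in Ioi (0 : ℝ), ((r : ℂ) ^ (d - 1)) *
      ∫ θ : Metric.sphere (0 : EuclideanSpace ℝ (Fin d)) 1, f (r • θ.1) ∂(surfaceMeasure d) := by
  let E := EuclideanSpace ℝ (Fin d)
  have : Nonempty (Fin d) := ⟨⟨0, hd⟩⟩
  have hmp := (volume : Measure E).measurePreserving_homeomorphUnitSphereProd
  have hemb := (homeomorphUnitSphereProd E).measurableEmbedding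
  set g : Metric.sphere (0 : E) 1 × Ioi (0 : ℝ) → ℂ := fun p => f (p.2.1 • p.1.1) with hg
  have hcomp : ∀ x : ({0}ᶜ : Set E), g (homeomorphUnitSphereProd E x) = f x.1 := by
    intro x
    have hx : ‖x.1‖ ≠ 0 := norm_ne_zero_iff.2 x.2
    simp [hg, homeomorphUnitSphereProd, smul_smul, mul_inv_cancel₀ hx]
  have hint : Integrable g ((volume : Measure E).toSphere.prod
      (Measure.volumeIoiPow (Module.finrank ℝ E - 1))) := by
    rw [← hmp.integrable_comp_emb hemb]
    have : g ∘ (homeomorphUnitSphereProd E) = fun x => f x.1 := funext hcomp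
    rw [this]
    have h1 : IntegrableOn f ({0}ᶜ : Set E) := hf.integrableOn
    exact (integrableOn_iff_comap_subtypeVal (measurableSet_singleton _).compl).1 h1
  have hdim : Module.finrank ℝ E = d := by simp [E]
  calc ∫ x, f x = ∫ x : ({0}ᶜ : Set E), f x.1 ∂((volume : Measure E).comap (↑)) := by
        rw [integral_subtype_comap (measurableSet_singleton _).compl f, restrict_compl_singleton]
    _ = ∫ p, g p ∂((volume : Measure E).toSphere.prod
          (Measure.volumeIoiPow (Module.finrank ℝ E - 1))) := by
        rw [← hmp.integral_comp hemb]
        simp_rw [hcomp]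
    _ = ∫ r : Ioi (0 : ℝ), (∫ θ, g (θ, r) ∂(surfaceMeasure d))
          ∂(Measure.volumeIoiPow (Module.finrank ℝ E - 1)) := integral_prod_symm _ hint
    _ = _ := by
        simp only [Measure.volumeIoiPow, ENNReal.ofReal]
        rw [integral_withDensity_eq_integral_smul
            ((measurable_subtype_coe.pow_const _).real_toNNReal),
          integral_subtype_comap measurableSet_Ioi
            (fun r => Real.toNNReal (r ^ (Module.finrank ℝ E - 1)) •
            (∫ θ : Metric.sphere (0 : E) 1, f (r • θ.1) ∂(surfaceMeasure d)))]
        refine setIntegral_congr_fun measurableSet_Ioi fun r hr => ?_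
        rw [hdim]
        simp only [NNReal.smul_def]
        rw [Real.coe_toNNReal _ (pow_nonneg (le_of_lt hr) _), Complex.real_smul]
        push_cast
        rfl

instance (d : ℕ) : IsFiniteMeasure (surfaceMeasure d) := by
  unfold surfaceMeasure; infer_instance

theorem norm_exp_neg_two_pi_I_mul (t : ℝ) :
    ‖Complex.exp (-(2 * Real.pi * Complex.I * (t : ℂ)))‖ = 1 := by
  have : -(2 * Real.pi * Complex.I * (t : ℂ)) = ((-(2 * Real.pi * t) : ℝ) : ℂ) * Complex.I := by
    push_cast; ring
  rw [this, Complex.norm_exp_ofReal_mul_I]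

theorem norm_surfaceFourier_le (d : ℕ) (η : Fin d → ℝ) :
    ‖surfaceFourier d η‖ ≤ (surfaceMeasure d).real Set.univ := by
  refine (norm_integral_le_of_norm_le_const (C := 1) ?_).trans (by simp)
  refine Filter.Eventually.of_forall fun θ => ?_
  rw [norm_exp_neg_two_pi_I_mul]

theorem continuous_surfaceFourier (d : ℕ) : Continuous (surfaceFourier d) := by
  unfold surfaceFourier
  refine continuous_of_dominated (bound := fun _ => 1) ?_ ?_ (integrable_const _) ?_
  · intro η
    refine Continuous.aestronglyMeasurable ?_
    fun_prop
  · intro η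
    refine Filter.Eventually.of_forall fun θ => ?_
    rw [norm_exp_neg_two_pi_I_mul]
  · refine Filter.Eventually.of_forall fun θ => ?_
    fun_prop

/-- The Gaussian factor on an arc in dimension `d`, as a function of the distance `τ` from the
centre, where `w` stands for the squared length of the frequency. -/
noncomputable def arcKernel (ε : ℝ) (d : ℕ) (w τ : ℝ) : ℂ :=
  ((arcParam ε τ ^ (1 / 2 : ℂ))⁻¹) ^ d * Complex.exp (-Real.pi * w / arcParam ε τ)

theorem arcParam_arg_ne_pi {ε : ℝ} (hε : 0 < ε) (τ : ℝ) : (arcParam ε τ).arg ≠ Real.pi := by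
  intro h
  have := (Complex.arg_eq_pi_iff.1 h).1
  rw [arcParam_re] at this
  linarith

theorem norm_arcKernel_le {ε : ℝ} (hε : 0 < ε) (d : ℕ) {w : ℝ} (hw : 0 ≤ w) (τ : ℝ) :
    ‖arcKernel ε d w τ‖ ≤ ‖arcParam ε τ‖ ^ (-((d : ℝ) / 2)) := by
  have ha := norm_pos_iff.2 (arcParam_ne_zero hε τ)
  rw [arcKernel, norm_mul, norm_pow, norm_inv]
  have e2 : ‖Complex.exp (-Real.pi * w / arcParam ε τ)‖ ≤ 1 := by
    rw [Complex.norm_exp, Real.exp_le_one_iff]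
    have : -(Real.pi : ℂ) * w / arcParam ε τ = ((-Real.pi * w : ℝ) : ℂ) * (arcParam ε τ)⁻¹ := by
      push_cast; rw [div_eq_mul_inv]
    rw [this, Complex.re_ofReal_mul, Complex.inv_re, arcParam_re, Complex.normSq_eq_norm_sq]
    have : 0 ≤ Real.pi * w * (2 * ε / ‖arcParam ε τ‖ ^ 2) := by positivity
    linarith
  have e3 : ((‖arcParam ε τ‖ ^ (1 / 2 : ℝ))⁻¹) ^ d = ‖arcParam ε τ‖ ^ (-((d : ℝ) / 2)) := by
    rw [← Real.rpow_neg ha.le, ← Real.rpow_natCast, ← Real.rpow_mul ha.le]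
    congr 1; ring
  rw [norm_arcParam_cpow_half, e3]
  exact mul_le_of_le_one_right (by positivity) e2

theorem continuous_arcParam (ε : ℝ) : Continuous (arcParam ε) := by
  unfold arcParam
  fun_prop

theorem continuous_arcKernel {ε : ℝ} (hε : 0 < ε) (d : ℕ) (w : ℝ) :
    Continuous (arcKernel ε d w) := by
  unfold arcKernel
  have ha := continuous_arcParam ε
  have h0 := arcParam_ne_zero hε
  refine Continuous.mul (Continuous.pow (Continuous.inv₀ ?_ ?_) _) ?_
  · refine ha.cpow continuous_const fun τ => ?_
    left
    rw [arcParam_re]; positivity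
  · intro τ h
    rw [Complex.cpow_eq_zero_iff] at h
    exact h0 τ h.1
  · exact Complex.continuous_exp.comp (continuous_const.div ha h0)

theorem integrable_arcKernel {ε : ℝ} (hε : 0 < ε) {d : ℕ} (hd : 3 ≤ d) {w : ℝ} (hw : 0 ≤ w) :
    Integrable (arcKernel ε d w) := by
  have hd' : (3 : ℝ) ≤ d := by exact_mod_cast hd
  -- compare `‖a‖² = 4 (ε² + τ²)` with `1 + τ²`; the exponent `d / 2` exceeds one
  set m := min 1 (ε ^ 2) with hm
  have hm0 : 0 < m := by positivity
  have h1 := (integrable_rpow_neg_one_add_norm_sq (E := ℝ) (r := (d : ℝ) / 2) (μ := volume)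
    (by simp; linarith)).const_mul (m ^ (-((d : ℝ) / 2) / 2))
  refine h1.mono' (continuous_arcKernel hε d w).aestronglyMeasurable
    (Filter.Eventually.of_forall fun τ => (norm_arcKernel_le hε d hw τ).trans ?_)
  have ha := norm_pos_iff.2 (arcParam_ne_zero hε τ)
  have e : ‖arcParam ε τ‖ ^ (-((d : ℝ) / 2)) = (‖arcParam ε τ‖ ^ 2) ^ (-((d : ℝ) / 2) / 2) := by
    rw [← Real.rpow_natCast, ← Real.rpow_mul ha.le]
    congr 1; push_cast; ring
  rw [e, ← Real.mul_rpow hm0.le (by positivity)]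
  refine Real.rpow_le_rpow_of_nonpos (by positivity) ?_ (by linarith)
  rw [norm_arcParam_sq, Real.norm_eq_abs, sq_abs]
  have h1 : m ≤ 1 := min_le_left _ _
  have h2 : m ≤ ε ^ 2 := min_le_right _ _
  nlinarith [sq_nonneg τ, sq_nonneg ε]

/-- The Gaussian integral over `ℝ^d`, computed in polar coordinates. -/
theorem integral_Ioi_surfaceFourier {ε : ℝ} (hε : 0 < ε) {d : ℕ} (hd : 0 < d) (η : Fin d → ℝ)
    (τ : ℝ) :
    ∫ r in Ioi (0 : ℝ), ((r : ℂ) ^ (d - 1)) *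
      (Complex.exp (-Real.pi * arcParam ε τ * (r : ℂ) ^ 2) * surfaceFourier d (fun i => r * η i)) =
    arcKernel ε d (∑ i, η i ^ 2) τ := by
  set a := arcParam ε τ with ha
  have ha0 : a ≠ 0 := arcParam_ne_zero hε τ
  have hb : 0 < (Real.pi * a).re := by
    rw [Complex.re_ofReal_mul, ha, arcParam_re]
    have := Real.pi_pos
    positivity
  set w : EuclideanSpace ℝ (Fin d) := WithLp.toLp 2 η with hw
  have hint := GaussianFourier.integrable_cexp_neg_mul_sq_norm_add_of_euclideanSpace hb
    (-(2 * Real.pi * Complex.I)) w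
  have hG := GaussianFourier.integral_cexp_neg_mul_sq_norm_add_of_euclideanSpace hb
    (-(2 * Real.pi * Complex.I)) w
  rw [integral_polar hd _ hint] at hG
  have hR : (Real.pi / (Real.pi * a) : ℂ) ^ ((Fintype.card (Fin d) : ℂ) / 2) *
      Complex.exp ((-(2 * Real.pi * Complex.I)) ^ 2 * (‖w‖ : ℂ) ^ 2 / (4 * (Real.pi * a))) =
      arcKernel ε d (∑ i, η i ^ 2) τ := by
    rw [arcKernel, ← ha]
    have hpi : (Real.pi : ℂ) ≠ 0 := by exact_mod_cast Real.pi_ne_zero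
    congr 1
    · rw [show (Real.pi / (Real.pi * a) : ℂ) = a⁻¹ by field_simp, Fintype.card_fin,
        Complex.inv_cpow _ _ (arcParam_arg_ne_pi hε τ), inv_pow, ← Complex.cpow_nat_mul]
      congr 2
      ring
    · congr 1
      have hn : ((‖w‖ : ℝ) : ℂ) ^ 2 = ((∑ i, η i ^ 2 : ℝ) : ℂ) := by
        rw [← Complex.ofReal_pow, EuclideanSpace.real_norm_sq_eq]
      rw [hn]
      have : (-(2 * (Real.pi : ℂ) * Complex.I)) ^ 2 = -4 * (Real.pi : ℂ) ^ 2 := by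
        rw [neg_sq, mul_pow, mul_pow, Complex.I_sq]; ring
      rw [this]
      field_simp
  rw [hR] at hG
  rw [← hG]
  refine setIntegral_congr_fun measurableSet_Ioi fun r hr => ?_
  have hr' : (0 : ℝ) < r := hr
  congr 1
  rw [surfaceFourier, ← integral_const_mul]
  refine integral_congr_ae (Filter.Eventually.of_forall fun θ => ?_)
  simp only
  rw [← Complex.exp_add]
  congr 1
  have hθ : ‖θ.1‖ = 1 := by simp
  rw [norm_smul, hθ, mul_one, Real.norm_of_nonneg hr'.le]
  have hinn : inner ℝ w (r • θ.1) = ∑ i, r * η i * θ.1 i := by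
    simp only [PiLp.inner_apply, hw]
    refine Finset.sum_congr rfl fun i _ => ?_
    simp
    ring
  rw [hinn]
  ring

/-- The function `½ s^{d/2-1} 𝓕σ(√s η) e^{-2πεs}` of `s > 0`, whose Fourier transform is the arc
kernel; the variable `s` is the square of the radius, and the function is extended by zero to
`s ≤ 0`. -/
noncomputable def radialProfile (ε : ℝ) (d : ℕ) (η : Fin d → ℝ) (s : ℝ) : ℂ :=
  (Ioi (0 : ℝ)).indicator (fun s => (1 / 2 : ℂ) * ((s ^ ((d : ℝ) / 2 - 1) : ℝ) : ℂ) *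
    surfaceFourier d (fun i => √s * η i) * ((Real.exp (-(2 * Real.pi * ε * s)) : ℝ) : ℂ)) s

theorem integrable_radialProfile {ε : ℝ} (hε : 0 < ε) {d : ℕ} (hd : 0 < d) (η : Fin d → ℝ) :
    Integrable (radialProfile ε d η) := by
  have hd' : (0 : ℝ) < d := by exact_mod_cast hd
  have hpi := Real.pi_pos
  unfold radialProfile
  rw [integrable_indicator_iff measurableSet_Ioi]
  have h := (integrableOn_rpow_mul_exp_neg_mul_rpow (p := 1) (s := (d : ℝ) / 2 - 1)
    (b := 2 * Real.pi * ε) (by linarith) one_pos (by positivity)).const_mul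
    ((surfaceMeasure d).real Set.univ)
  refine Integrable.mono' h ?_ ?_
  · refine Measurable.aestronglyMeasurable ?_
    have := (continuous_surfaceFourier d).measurable
    have h2 : Measurable fun s : ℝ => surfaceFourier d (fun i => √s * η i) :=
      this.comp (by fun_prop)
    fun_prop
  · filter_upwards [ae_restrict_mem measurableSet_Ioi] with s hs
    have hs' : (0 : ℝ) < s := hs
    rw [norm_mul, norm_mul, norm_mul, Complex.norm_real, Complex.norm_real,
      Real.norm_of_nonneg (by positivity), Real.norm_of_nonneg (by positivity), Real.rpow_one]
    have h1 := norm_surfaceFourier_le d (fun i => √s * η i)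
    have h3 : ‖(1 / 2 : ℂ)‖ ≤ 1 := by norm_num
    have h4 : (0 : ℝ) ≤ (surfaceMeasure d).real Set.univ := measureReal_nonneg
    calc _ ≤ 1 * s ^ ((d : ℝ) / 2 - 1) * (surfaceMeasure d).real Set.univ *
          Real.exp (-(2 * Real.pi * ε * s)) := by gcongr
      _ = _ := by rw [neg_mul]; ring

open FourierTransform in
theorem fourier_radialProfile {ε : ℝ} (hε : 0 < ε) {d : ℕ} (hd : 0 < d) (η : Fin d → ℝ)
    (t : ℝ) : 𝓕 (radialProfile ε d η) t = arcKernel ε d (∑ i, η i ^ 2) (-t) := by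
  rw [Real.fourier_real_eq_integral_exp_smul, ← integral_Ioi_surfaceFourier hε hd]
  have h1 : ∀ s : ℝ, Complex.exp (((-2 * Real.pi * s * t : ℝ) : ℂ) * Complex.I) •
      radialProfile ε d η s = (Ioi (0 : ℝ)).indicator (fun s : ℝ =>
        (1 / 2 : ℂ) * ((s ^ ((d : ℝ) / 2 - 1) : ℝ) : ℂ) *
        (Complex.exp (-Real.pi * arcParam ε (-t) * s) *
        surfaceFourier d (fun i => √s * η i))) s := by
    intro s
    rw [radialProfile, indicator, indicator]
    split_ifs with hs
    · have : Complex.exp (-Real.pi * arcParam ε (-t) * s) =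
          Complex.exp (((-2 * Real.pi * s * t : ℝ) : ℂ) * Complex.I) *
          ((Real.exp (-(2 * Real.pi * ε * s)) : ℝ) : ℂ) := by
        rw [Complex.ofReal_exp, ← Complex.exp_add]
        congr 1
        rw [arcParam]
        push_cast
        ring
      rw [this, smul_eq_mul]
      ring
    · simp
  simp_rw [h1]
  -- substitute `s = r²`
  rw [integral_indicator measurableSet_Ioi, ← integral_comp_rpow_Ioi_of_pos (p := 2) two_pos]
  refine setIntegral_congr_fun measurableSet_Ioi fun r hr => ?_
  have hr' : (0 : ℝ) < r := hr
  have e1 : √(r ^ (2 : ℝ)) = r := by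
    rw [Real.rpow_two, Real.sqrt_sq hr'.le]
  have e2 : (r ^ (2 : ℝ)) ^ ((d : ℝ) / 2 - 1) = r ^ ((d : ℝ) - 2) := by
    rw [← Real.rpow_mul hr'.le]; congr 1; ring
  rw [e1, e2]
  have e3 : ((r : ℂ)) ^ (d - 1) = ((r ^ ((2 : ℝ) - 1) : ℝ) : ℂ) * ((r ^ ((d : ℝ) - 2) : ℝ) : ℂ) := by
    rw [← Complex.ofReal_mul, ← Real.rpow_add hr', ← Complex.ofReal_pow, ← Real.rpow_natCast,
      Nat.cast_sub hd]
    congr 2; push_cast; ring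
  rw [e3, Complex.real_smul]
  push_cast
  rw [show ((r ^ (2 : ℝ) : ℝ) : ℂ) = (r : ℂ) ^ 2 by rw [Real.rpow_two]; push_cast; rfl]
  ring

open FourierTransform in
/-- Fourier inversion identifies the singular integral with the Fourier transform of the surface
measure. -/
theorem integral_arcKernel {ε : ℝ} (hε : 0 < ε) {d : ℕ} (hd : 3 ≤ d) (η : Fin d → ℝ) {L : ℝ}
    (hL : 0 < L) :
    ∫ τ : ℝ, Complex.exp (2 * Real.pi * ε * L) *
      Complex.exp (-(2 * Real.pi * Complex.I * (L * τ : ℝ))) *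
      arcKernel ε d (∑ i, η i ^ 2) τ =
    (1 / 2 : ℂ) * ((L ^ ((d : ℝ) / 2 - 1) : ℝ) : ℂ) * surfaceFourier d (fun i => √L * η i) := by
  have hd0 : 0 < d := by omega
  have hF : 𝓕 (radialProfile ε d η) = fun t => arcKernel ε d (∑ i, η i ^ 2) (-t) :=
    funext fun t => fourier_radialProfile hε hd0 η t
  have hFi : Integrable (𝓕 (radialProfile ε d η)) := by
    rw [hF]
    exact (integrable_arcKernel hε hd (Finset.sum_nonneg fun i _ => sq_nonneg (η i))).comp_neg
  have hcont : ContinuousAt (radialProfile ε d η) L := by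
    have h1 : ContinuousAt (fun s : ℝ => (1 / 2 : ℂ) * ((s ^ ((d : ℝ) / 2 - 1) : ℝ) : ℂ) *
      surfaceFourier d (fun i => √s * η i) * ((Real.exp (-(2 * Real.pi * ε * s)) : ℝ) : ℂ)) L := by
      have h2 : ContinuousAt (fun s : ℝ => surfaceFourier d (fun i => √s * η i)) L :=
        ((continuous_surfaceFourier d).comp (by fun_prop)).continuousAt
      have h3 : ContinuousAt (fun s : ℝ => ((s ^ ((d : ℝ) / 2 - 1) : ℝ) : ℂ)) L :=
        Complex.continuous_ofReal.continuousAt.comp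
          (Real.continuousAt_rpow_const _ _ (Or.inl hL.ne'))
      have h4 : ContinuousAt (fun s : ℝ => ((Real.exp (-(2 * Real.pi * ε * s)) : ℝ) : ℂ)) L := by
        fun_prop
      exact ((continuousAt_const.mul h3).mul h2).mul h4
    refine h1.congr ?_
    filter_upwards [Ioi_mem_nhds hL] with s hs
    rw [radialProfile, indicator_of_mem hs]
  have hinv := (integrable_radialProfile hε hd0 η).fourierInv_fourier_eq hFi hcont
  rw [Real.fourierInv_eq', hF] at hinv
  rw [← integral_neg_eq_self] at hinv
  simp only [neg_neg] at hinv
  have h5 : ∀ τ : ℝ, Complex.exp (2 * Real.pi * ε * L) *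
      Complex.exp (-(2 * Real.pi * Complex.I * (L * τ : ℝ))) *
      arcKernel ε d (∑ i, η i ^ 2) τ = Complex.exp (2 * Real.pi * ε * L) *
      (Complex.exp (((2 * Real.pi * inner ℝ (-τ) L : ℝ) : ℂ) * Complex.I) •
        arcKernel ε d (∑ i, η i ^ 2) τ) := by
    intro τ
    rw [smul_eq_mul, mul_assoc]
    congr 3
    simp
    ring
  simp_rw [h5]
  rw [integral_const_mul, hinv, radialProfile, indicator_of_mem (show L ∈ Ioi (0 : ℝ) from hL)]
  have h6 : Complex.exp (2 * Real.pi * ε * L) * ((Real.exp (-(2 * Real.pi * ε * L)) : ℝ) : ℂ) = 1 := by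
    rw [Complex.ofReal_exp, ← Complex.exp_add, ← Complex.exp_zero]
    congr 1
    push_cast; ring
  linear_combination ((1 / 2 : ℂ) * ((L ^ ((d : ℝ) / 2 - 1) : ℝ) : ℂ) *
    surfaceFourier d (fun i => √L * η i)) * h6

/-! ### The generating function of the exponential sum -/

/-- Expansion of a finite product of absolutely convergent series over `ℤ` as a series over
`ℤ^d`. -/
theorem hasSum_prod_tsum : ∀ {d : ℕ} (f : Fin d → ℤ → ℂ), (∀ i, Summable fun m => ‖f i m‖) →
    (Summable fun x : Fin d → ℤ => ‖∏ i, f i (x i)‖) ∧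
    HasSum (fun x : Fin d → ℤ => ∏ i, f i (x i)) (∏ i, ∑' m, f i m) := by
  intro d
  induction d with
  | zero =>
    intro f _
    refine ⟨(hasSum_fintype _).summable, ?_⟩
    simp
  | succ d ih =>
    intro f hf
    obtain ⟨h1, h2⟩ := ih (fun i => f i.succ) (fun i => hf i.succ)
    have hmul : ∀ (u : ℤ → ℂ) (v : (Fin d → ℤ) → ℂ) (b : ℂ), Summable (fun m => ‖u m‖) →
        Summable (fun x => ‖v x‖) → HasSum v b →
        Summable (fun p : ℤ × (Fin d → ℤ) => ‖u p.1 * v p.2‖) ∧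
        HasSum (fun p : ℤ × (Fin d → ℤ) => u p.1 * v p.2) ((∑' m, u m) * b) := by
      intro u v b hu hv hb
      have hs := Summable.mul_norm hu hv
      exact ⟨hs, HasSum.mul hu.of_norm.hasSum hb hs.of_norm⟩
    obtain ⟨hs, hh⟩ := hmul (f 0) (fun x => ∏ i, f (Fin.succ i) (x i)) _ (hf 0) h1 h2
    have he : ∀ p : ℤ × (Fin d → ℤ),
        ∏ i, f i ((Fin.consEquiv fun _ => ℤ) p i) = f 0 p.1 * ∏ i, f (Fin.succ i) (p.2 i) := by
      intro p
      rw [Fin.prod_univ_succ]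
      simp [Fin.consEquiv]
    constructor
    · rw [← (Fin.consEquiv fun _ => ℤ).summable_iff]
      refine hs.congr fun p => ?_
      simp only [Function.comp_apply]
      rw [he]
    · rw [← (Fin.consEquiv fun _ => ℤ).hasSum_iff, Fin.prod_univ_succ]
      convert hh using 1
      exact funext he

theorem norm_theta_summand (ε α ξ : ℝ) (m : ℤ) :
    ‖Complex.exp (-Real.pi * arcParam ε α * m ^ 2 + 2 * Real.pi * (Complex.I * ξ) * m)‖ =
      Real.exp (-(2 * Real.pi * ε * (m : ℝ) ^ 2)) := by
  rw [Complex.norm_exp]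
  congr 1
  have h : -(Real.pi : ℂ) * arcParam ε α * m ^ 2 + 2 * Real.pi * (Complex.I * ξ) * m =
      ((-(Real.pi * (m : ℝ) ^ 2) : ℝ) : ℂ) * arcParam ε α +
        ((2 * Real.pi * ξ * m : ℝ) : ℂ) * Complex.I := by
    push_cast; ring
  rw [h, Complex.add_re, Complex.re_ofReal_mul, Complex.re_ofReal_mul, arcParam_re, Complex.I_re]
  ring

theorem summable_norm_theta_summand {ε : ℝ} (hε : 0 < ε) :
    Summable fun m : ℤ => Real.exp (-(2 * Real.pi * ε * (m : ℝ) ^ 2)) := by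
  have h := (summable_exp_neg_quadratic (a := arcParam ε 0) (by rw [arcParam_re]; positivity)
    (Complex.I * (0 : ℝ))).norm
  refine h.congr fun m => ?_
  rw [norm_theta_summand]

theorem continuous_theta {ε : ℝ} (hε : 0 < ε) (ξ : ℝ) : Continuous fun α => theta ε α ξ := by
  unfold theta
  refine continuous_tsum (fun m => ?_) (summable_norm_theta_summand hε) fun m α =>
    (norm_theta_summand ε α ξ m).le
  have := continuous_arcParam ε
  fun_prop

theorem integral_exp_int_period (k : ℤ) (c : ℝ) :
    ∫ α in c..(c + 1), Complex.exp (2 * Real.pi * Complex.I * k * α) = if k = 0 then 1 else 0 := by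
  split_ifs with hk
  · simp [hk]
  · have h0 : (2 * Real.pi * Complex.I * k : ℂ) ≠ 0 := by
      have : (k : ℂ) ≠ 0 := by exact_mod_cast hk
      have := Complex.two_pi_I_ne_zero
      simp_all
    rw [integral_exp_mul_complex h0]
    have : Complex.exp (2 * Real.pi * Complex.I * k * ((c + 1 : ℝ) : ℂ)) =
        Complex.exp (2 * Real.pi * Complex.I * k * (c : ℂ)) := by
      rw [Complex.exp_eq_exp_iff_exists_int]
      exact ⟨k, by push_cast; ring⟩
    rw [this, sub_self, zero_div]

/-- The circle method identity: the exponential sum over the sphere is a Fourier coefficient of the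
generating function. -/
theorem wHat_eq_integral {ε : ℝ} (hε : 0 < ε) (d lam : ℕ) (ξ : Fin d → ℝ) (c : ℝ) :
    wHat d lam ξ = ∫ α in c..(c + 1),
      Complex.exp (2 * Real.pi * ε * lam) *
        Complex.exp (-(2 * Real.pi * Complex.I * (lam * α : ℝ))) * ∏ i, theta ε α (ξ i) := by
  set f : ℝ → Fin d → ℤ → ℂ := fun α i m =>
    Complex.exp (-Real.pi * arcParam ε α * m ^ 2 + 2 * Real.pi * (Complex.I * ξ i) * m) with hf
  have hfn : ∀ α i m, ‖f α i m‖ = Real.exp (-(2 * Real.pi * ε * (m : ℝ) ^ 2)) :=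
    fun α i m => norm_theta_summand ε α (ξ i) m
  have hfs : ∀ α i, Summable fun m => ‖f α i m‖ := by
    intro α i
    simp_rw [hfn]
    exact summable_norm_theta_summand hε
  set pre : ℝ → ℂ := fun α => Complex.exp (2 * Real.pi * ε * lam) *
        Complex.exp (-(2 * Real.pi * Complex.I * (lam * α : ℝ))) with hpre
  have hpren : ∀ α, ‖pre α‖ = Real.exp (2 * Real.pi * ε * lam) := by
    intro α
    rw [hpre]
    simp only
    rw [norm_mul, norm_exp_neg_two_pi_I_mul, mul_one, Complex.norm_exp]
    congr 1
    rw [show (2 * Real.pi * ε * lam : ℂ) = ((2 * Real.pi * ε * lam : ℝ) : ℂ) by push_cast; rfl,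
      Complex.ofReal_re]
  -- the norm of a summand does not depend on `α`, so its value at `α = 0` dominates
  set bound : (Fin d → ℤ) → ℝ := fun x => Real.exp (2 * Real.pi * ε * lam) * ‖∏ i, f 0 i (x i)‖
    with hbound
  have hbs : Summable bound := ((hasSum_prod_tsum (f 0) (hfs 0)).1).mul_left _
  have hbd : ∀ x α, ‖pre α * ∏ i, f α i (x i)‖ ≤ bound x := by
    intro x α
    rw [norm_mul, hpren, hbound]
    simp only [norm_prod, hfn]
    exact le_rfl
  have hsum := intervalIntegral.hasSum_integral_of_dominated_convergence (μ := volume)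
    (a := c) (b := c + 1)
    (F := fun (x : Fin d → ℤ) α => pre α * ∏ i, f α i (x i))
    (f := fun α => pre α * ∏ i, theta ε α (ξ i)) (fun x _ => bound x)
    (fun x => by
      refine Continuous.aestronglyMeasurable ?_
      have := continuous_arcParam ε
      simp only [hpre, hf]
      fun_prop)
    (fun x => Filter.Eventually.of_forall fun α _ => hbd x α)
    (Filter.Eventually.of_forall fun α _ => hbs)
    (by simp)
    (Filter.Eventually.of_forall fun α _ =>
      ((hasSum_prod_tsum (f α) (hfs α)).2).mul_left (pre α))
  have hterm : ∀ x : Fin d → ℤ, ∫ α in c..(c + 1), pre α * ∏ i, f α i (x i) =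
      if x ∈ (latticeSphere_finite d lam).toFinset then
        Complex.exp (2 * Real.pi * Complex.I * (∑ i, ξ i * (x i : ℝ) : ℝ)) else 0 := by
    intro x
    set k : ℤ := ∑ i, x i ^ 2 - lam with hk
    have e : ∀ α : ℝ, pre α * ∏ i, f α i (x i) =
        Complex.exp (-(2 * Real.pi * ε * k)) *
        Complex.exp (2 * Real.pi * Complex.I * (∑ i, ξ i * (x i : ℝ) : ℝ)) *
        Complex.exp (2 * Real.pi * Complex.I * k * α) := by
      intro α
      simp only [hpre, hf]
      rw [← Complex.exp_sum, ← Complex.exp_add, ← Complex.exp_add, ← Complex.exp_add,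
        ← Complex.exp_add]
      congr 1
      rw [Finset.sum_add_distrib, ← Finset.mul_sum, arcParam, hk]
      push_cast
      have : ∑ i, 2 * (Real.pi : ℂ) * (Complex.I * ξ i) * x i =
          2 * Real.pi * Complex.I * ∑ i, (ξ i : ℂ) * x i := by
        rw [Finset.mul_sum]
        exact Finset.sum_congr rfl fun i _ => by ring
      rw [this]
      ring
    simp_rw [e]
    rw [intervalIntegral.integral_const_mul, integral_exp_int_period]
    have hmem : x ∈ (latticeSphere_finite d lam).toFinset ↔ k = 0 := by
      rw [Set.Finite.mem_toFinset, latticeSphere, hk, sub_eq_zero]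
      rfl
    by_cases hk0 : k = 0
    · rw [if_pos (hmem.2 hk0), if_pos hk0, hk0]
      simp
    · rw [if_neg (fun h => hk0 (hmem.1 h)), if_neg hk0, mul_zero]
  simp_rw [hterm] at hsum
  have hfin := hasSum_sum_of_ne_finset_zero (L := SummationFilter.unconditional _)
    (f := fun x : Fin d → ℤ =>
      if x ∈ (latticeSphere_finite d lam).toFinset then
        Complex.exp (2 * Real.pi * Complex.I * (∑ i, ξ i * (x i : ℝ) : ℝ)) else 0)
      (s := (latticeSphere_finite d lam).toFinset) (fun x hx => if_neg hx)
  have := HasSum.unique hfin hsum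
  rw [← this, wHat]
  exact Finset.sum_congr rfl fun x hx => (if_pos hx).symm

/-! ### The arcs and their complement -/

/-- The half-length `1 / (2 q N)`, `N = ⌊√lam⌋`, of the arc about a fraction with denominator
`q`. -/
noncomputable def arcRadius (lam q : ℕ) : ℝ := 1 / (2 * q * (Nat.sqrt lam : ℝ))

theorem arcRadius_pos {lam q : ℕ} (hlam : 0 < lam) (hq : 0 < q) : 0 < arcRadius lam q := by
  have hq' : (0 : ℝ) < q := by exact_mod_cast hq
  have hN0 : (0 : ℝ) < Nat.sqrt lam := by exact_mod_cast Nat.sqrt_pos.2 hlam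
  rw [arcRadius]; positivity

theorem arcRadius_le {lam q : ℕ} (hlam : 0 < lam) (hq : 0 < q) :
    arcRadius lam q ≤ 1 / (((Nat.sqrt lam : ℝ) + 1) * q) := by
  have hq' : (0 : ℝ) < q := by exact_mod_cast hq
  have hN0 : (1 : ℝ) ≤ Nat.sqrt lam := by exact_mod_cast Nat.sqrt_pos.2 hlam
  rw [arcRadius]
  apply one_div_le_one_div_of_le (by positivity)
  nlinarith

/-- The arcs of half-length `1 / (2 q N)` about distinct reduced fractions are disjoint. -/
theorem eq_of_abs_sub_lt_arcRadius {lam : ℕ} {α : ℝ} {p q p' q' : ℕ}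
    (hq : q ∈ Finset.Icc 1 (Nat.sqrt lam)) (hq' : q' ∈ Finset.Icc 1 (Nat.sqrt lam))
    (hp : p ∈ numerators q) (hp' : p' ∈ numerators q')
    (h : |α - (p : ℝ) / q| < arcRadius lam q) (h' : |α - (p' : ℝ) / q'| < arcRadius lam q') :
    q = q' ∧ p = p' := by
  rw [Finset.mem_Icc] at hq hq'
  have hc := (Finset.mem_filter.1 hp).2
  have hc' := (Finset.mem_filter.1 hp').2
  have a1 : (0 : ℝ) < q := by exact_mod_cast hq.1
  have a2 : (0 : ℝ) < q' := by exact_mod_cast hq'.1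
  have a3 : (q : ℝ) ≤ Nat.sqrt lam := by exact_mod_cast hq.2
  have a4 : (q' : ℝ) ≤ Nat.sqrt lam := by exact_mod_cast hq'.2
  have a5 : (0 : ℝ) < Nat.sqrt lam := a1.trans_le a3
  have h1 : |(p : ℝ) / q - p' / q'| < arcRadius lam q + arcRadius lam q' := by
    have := abs_sub_le ((p : ℝ) / q) α (p' / q')
    rw [abs_sub_comm _ α] at this
    linarith
  have h2 : arcRadius lam q + arcRadius lam q' ≤ 1 / (q * q') := by
    rw [arcRadius, arcRadius, div_add_div _ _ (by positivity) (by positivity),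
      div_le_div_iff₀ (by positivity) (by positivity)]
    have : (q : ℝ) + q' ≤ 2 * Nat.sqrt lam := by linarith
    have h3 := mul_le_mul_of_nonneg_left this
      (show 0 ≤ 2 * (q : ℝ) * q' * Nat.sqrt lam by positivity)
    nlinarith
  have h3 : |(p : ℝ) * q' - p' * q| < 1 := by
    have e : (p : ℝ) / q - p' / q' = (p * q' - p' * q) / (q * q') := by
      field_simp
    rw [e, abs_div, abs_of_pos (show (0 : ℝ) < q * q' by positivity),
      div_lt_iff₀ (by positivity)] at h1
    calc _ < (arcRadius lam q + arcRadius lam q') * (q * q') := h1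
      _ ≤ 1 / (q * q') * (q * q') := by gcongr
      _ = 1 := by field_simp
  have h4 : (p : ℤ) * q' - p' * q = 0 := by
    rw [← Int.abs_lt_one_iff]
    exact_mod_cast h3
  have h5 : p * q' = p' * q := by
    have : (p : ℤ) * q' = p' * q := by linarith
    exact_mod_cast this
  have h6 : q = q' := by
    refine Nat.dvd_antisymm ?_ ?_
    · exact (Nat.Coprime.dvd_of_dvd_mul_left hc.symm (Dvd.intro_left p' h5.symm))
    · exact (Nat.Coprime.dvd_of_dvd_mul_left hc'.symm (Dvd.intro_left p h5))
  subst h6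
  exact ⟨rfl, Nat.eq_of_mul_eq_mul_right hq.1 h5⟩

/-- The approximation of the product of theta functions near the fraction `p / q`, cut off to the
arc of the fraction, as a function of the distance `τ` from the centre. -/
noncomputable def arcMain (lam : ℕ) {d : ℕ} (ξ : Fin d → ℝ) (p q : ℕ) (τ : ℝ) : ℂ :=
  (Ioo (-arcRadius lam q) (arcRadius lam q)).indicator
    (fun τ => ∏ i, thetaTerm (1 / (lam : ℝ)) τ (ξ i) p q (round (q * ξ i))) τ

theorem mem_Ioo_neg_iff_abs_lt (x r : ℝ) : x ∈ Ioo (-r) r ↔ |x| < r := by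
  rw [mem_Ioo, abs_lt]

/-- The centres of the arcs that meet the interval of integration have numerators between `1` and
the denominator. -/
theorem numerator_mem_of_abs_sub_lt {lam : ℕ} (hlam : 0 < lam) {α : ℝ}
    (hα : α ∈ Icc (1 / (2 * (Nat.sqrt lam : ℝ))) (1 / (2 * (Nat.sqrt lam : ℝ)) + 1))
    {p : ℤ} {q : ℕ} (hq : 0 < q) (hqN : q ≤ Nat.sqrt lam) (h : |α - (p : ℝ) / q| < arcRadius lam q) :
    1 ≤ p ∧ p ≤ q := by
  have a1 : (1 : ℝ) ≤ q := by exact_mod_cast hq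
  have a3 : (q : ℝ) ≤ Nat.sqrt lam := by exact_mod_cast hqN
  have a5 : (0 : ℝ) < Nat.sqrt lam := by linarith
  have hr : arcRadius lam q ≤ 1 / (2 * (Nat.sqrt lam : ℝ)) := by
    rw [arcRadius]
    apply one_div_le_one_div_of_le (by positivity)
    nlinarith
  have h2 : 1 / (2 * (Nat.sqrt lam : ℝ)) ≤ 1 / (2 * q) := by
    apply one_div_le_one_div_of_le (by positivity)
    linarith
  have h3 : arcRadius lam q ≤ 1 / (2 * q) := hr.trans h2
  rw [abs_lt] at h
  have hd : (1 : ℝ) / (2 * q) + 1 / (2 * q) = 1 / q := by field_simp; norm_num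
  constructor
  · have : (0 : ℝ) < (p : ℝ) / q := by linarith [hα.1]
    have : (0 : ℝ) < p := by
      by_contra hneg
      push Not at hneg
      have := div_nonpos_of_nonpos_of_nonneg hneg (by linarith : (0 : ℝ) ≤ q)
      linarith
    exact_mod_cast this
  · have h4 : (p : ℝ) / q < 1 + 1 / q := by linarith [hα.2]
    have h5 : (p : ℝ) < q + 1 := by
      rw [div_lt_iff₀ (by linarith)] at h4
      calc (p : ℝ) < (1 + 1 / q) * q := h4
        _ = q + 1 := by field_simp
    exact Int.lt_add_one_iff.1 (by exact_mod_cast h5)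

/-- Pointwise approximation of the generating function by the sum of the arc contributions. Off the
arcs, Dirichlet's theorem puts the point at a distance of the order of `1 / (q N)` from some
fraction, where the generating function is small. -/
theorem norm_prod_theta_sub_arcs_le {d lam : ℕ} (hd : 0 < d) (hlam : 0 < lam) (ξ : Fin d → ℝ)
    (w : ℕ → ℂ) (hw : ∀ q, ‖w q‖ ≤ 1)
    (hw1 : ∀ q : ℕ, (∀ i, |q * ξ i - round (q * ξ i)| ≤ 1 / 8) → w q = 1) {α : ℝ}
    (hα : α ∈ Icc (1 / (2 * (Nat.sqrt lam : ℝ))) (1 / (2 * (Nat.sqrt lam : ℝ)) + 1)) :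
    ‖∏ i, theta (1 / (lam : ℝ)) α (ξ i) - ∑ q ∈ Finset.Icc 1 (Nat.sqrt lam), ∑ p ∈ numerators q,
      w q * arcMain lam ξ p q (α - (p : ℝ) / q)‖ ≤
      arcConst ^ d * (d * (lam : ℝ)) ^ ((d : ℝ) / 4) := by
  have hL : (0 : ℝ) < lam := by exact_mod_cast hlam
  by_cases hex : ∃ q ∈ Finset.Icc 1 (Nat.sqrt lam), ∃ p ∈ numerators q,
      |α - (p : ℝ) / q| < arcRadius lam q
  · obtain ⟨q, hq, p, hp, h⟩ := hex
    have hq0 : 0 < q := (Finset.mem_Icc.1 hq).1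
    have hcop := (Finset.mem_filter.1 hp).2
    rw [Finset.sum_eq_single_of_mem q hq, Finset.sum_eq_single_of_mem p hp]
    · rw [arcMain, indicator_of_mem ((mem_Ioo_neg_iff_abs_lt _ _).2 h)]
      have := norm_prod_theta_sub_le hL (α - (p : ℝ) / q) hd ξ (p := p) hq0
        (Nat.isCoprime_iff_coprime.2 hcop)
        (one_fourth_le_arcRate hlam hq0 (Finset.mem_Icc.1 hq).2
          (h.le.trans (arcRadius_le hlam hq0))) (w q) (hw q) (hw1 q)
      simpa using this
    · intro p' hp' hne
      rw [arcMain, indicator_of_notMem, mul_zero]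
      intro hmem
      rw [mem_Ioo_neg_iff_abs_lt] at hmem
      exact hne (eq_of_abs_sub_lt_arcRadius hq hq hp' hp hmem h).2
    · intro q' hq' hne
      refine Finset.sum_eq_zero fun p' hp' => ?_
      rw [arcMain, indicator_of_notMem, mul_zero]
      intro hmem
      rw [mem_Ioo_neg_iff_abs_lt] at hmem
      exact hne (eq_of_abs_sub_lt_arcRadius hq' hq hp' hp hmem h).1
  · rw [Finset.sum_eq_zero, sub_zero]
    · obtain ⟨r, hr1, hr2⟩ := Real.exists_rat_abs_sub_le_and_den_le α (Nat.sqrt_pos.2 hlam)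
      have hrd : (r : ℝ) = ((r.num : ℤ) : ℝ) / r.den := Rat.cast_def r
      have hcop : IsCoprime r.num (r.den : ℤ) := by
        rw [Int.isCoprime_iff_gcd_eq_one]
        exact r.reduced
      have hfar : arcRadius lam r.den ≤ |α - ((r.num : ℤ) : ℝ) / r.den| := by
        by_contra hlt
        push Not at hlt
        obtain ⟨h1, h2⟩ := numerator_mem_of_abs_sub_lt hlam hα r.pos hr2 hlt
        obtain ⟨p, hp⟩ := Int.eq_ofNat_of_zero_le (by omega : 0 ≤ r.num)
        refine hex ⟨r.den, Finset.mem_Icc.2 ⟨r.pos, hr2⟩, p, ?_, ?_⟩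
        · rw [numerators, Finset.mem_filter, Finset.mem_Icc]
          refine ⟨⟨by omega, by omega⟩, ?_⟩
          rw [hp] at hcop
          exact Nat.isCoprime_iff_coprime.1 hcop
        · rw [hp] at hlt
          simpa using hlt
      rw [hrd] at hr1
      have := norm_prod_theta_le_of_arcRate_le hL (α - ((r.num : ℤ) : ℝ) / r.den) hd ξ r.pos hcop
        (one_fourth_le_arcRate hlam r.pos hr2 hr1) (arcRate_le_two hlam r.pos hfar)
      simpa using this
    · intro q hq
      refine Finset.sum_eq_zero fun p hp => ?_
      rw [arcMain, indicator_of_notMem, mul_zero]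
      intro hmem
      rw [mem_Ioo_neg_iff_abs_lt] at hmem
      exact hex ⟨q, hq, p, hp, hmem⟩

theorem prod_thetaTerm_eq (ε τ : ℝ) {d : ℕ} (ξ : Fin d → ℝ) (p q : ℕ) (hq : 0 < q)
    (x : Fin d → ℤ) :
    ∏ i, thetaTerm ε τ (ξ i) p q (x i) =
      gaussG d p q x * arcKernel ε d (∑ i, ((x i : ℝ) / q - ξ i) ^ 2) τ := by
  simp only [thetaTerm]
  rw [Finset.prod_mul_distrib, Finset.prod_mul_distrib, ← gaussG_eq_prod d p q hq, arcKernel,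
    Finset.prod_const, Finset.card_univ, Fintype.card_fin, ← Complex.exp_sum, mul_assoc]
  congr 3
  rw [← Finset.sum_div, ← Finset.mul_sum]
  push_cast
  rfl

/-- The part of the singular integral outside the arc `(-T, T)`, with a factor `u` of modulus at
most one, is small, since the kernel is dominated by `(2 |τ|) ^ (-d / 2)`. -/
theorem norm_setIntegral_compl_arc_le {ε : ℝ} (hε : 0 < ε) {d : ℕ} (hd : 4 ≤ d) {w : ℝ}
    (hw : 0 ≤ w) {T : ℝ} (hT : 0 < T) (u : ℝ → ℂ) (hu : ∀ τ, ‖u τ‖ ≤ 1) (huc : Continuous u) :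
    ‖(∫ τ, u τ * arcKernel ε d w τ) - ∫ τ in Ioo (-T) T, u τ * arcKernel ε d w τ‖ ≤
      (2 * T) ^ (1 - (d : ℝ) / 2) := by
  have hd' : (4 : ℝ) ≤ d := by exact_mod_cast hd
  have hint : Integrable fun τ => u τ * arcKernel ε d w τ :=
    (integrable_arcKernel hε (by omega) hw).bdd_mul (c := 1) huc.aestronglyMeasurable
      (Filter.Eventually.of_forall hu)
  have hker : ∀ τ : ℝ, τ ≠ 0 → ‖u τ * arcKernel ε d w τ‖ ≤ (2 * |τ|) ^ (-((d : ℝ) / 2)) := by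
    intro τ hτ
    rw [norm_mul]
    refine (mul_le_of_le_one_left (norm_nonneg _) (hu τ)).trans
      ((norm_arcKernel_le hε d hw τ).trans ?_)
    have hτ' : 0 < |τ| := abs_pos.2 hτ
    refine Real.rpow_le_rpow_of_nonpos (by positivity) ?_ (by linarith)
    rw [← abs_of_nonneg (norm_nonneg (arcParam ε τ)), show 2 * |τ| = |2 * τ| by
      rw [abs_mul]; norm_num]
    rw [← sq_le_sq, norm_arcParam_sq]
    nlinarith [sq_nonneg ε]
  have hI : ∫ τ in Ioi T, (2 * τ) ^ (-((d : ℝ) / 2)) ≤ (2 * T) ^ (1 - (d : ℝ) / 2) / 2 := by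
    have e : ∀ τ ∈ Ioi T, (2 * τ) ^ (-((d : ℝ) / 2)) =
        2 ^ (-((d : ℝ) / 2)) * τ ^ (-((d : ℝ) / 2)) := by
      intro τ hτ
      have : (0 : ℝ) < τ := hT.trans hτ
      rw [Real.mul_rpow (by norm_num) this.le]
    rw [setIntegral_congr_fun measurableSet_Ioi e, integral_const_mul,
      integral_Ioi_rpow_of_lt (by linarith) hT]
    have e2 : (2 * T) ^ (1 - (d : ℝ) / 2) = 2 * 2 ^ (-((d : ℝ) / 2)) * T ^ (-((d : ℝ) / 2) + 1) := by
      rw [Real.mul_rpow (by norm_num) hT.le, show 1 - (d : ℝ) / 2 = -((d : ℝ) / 2) + 1 by ring,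
        Real.rpow_add_one (by norm_num)]
      ring
    rw [e2]
    have e3 : -T ^ (-((d : ℝ) / 2) + 1) / (-((d : ℝ) / 2) + 1) =
        T ^ (-((d : ℝ) / 2) + 1) / ((d : ℝ) / 2 - 1) := by
      rw [neg_div, ← div_neg]; congr 1; ring
    rw [e3]
    have h4 : T ^ (-((d : ℝ) / 2) + 1) / ((d : ℝ) / 2 - 1) ≤ T ^ (-((d : ℝ) / 2) + 1) :=
      div_le_self (by positivity) (by linarith)
    have h5 : (0 : ℝ) < 2 ^ (-((d : ℝ) / 2)) := by positivity
    have := mul_le_mul_of_nonneg_left h4 h5.le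
    linarith
  have hIi : IntegrableOn (fun τ : ℝ => (2 * τ) ^ (-((d : ℝ) / 2))) (Ioi T) := by
    have h := (integrableOn_Ioi_rpow_of_lt (a := -((d : ℝ) / 2)) (by linarith) hT).const_mul
      (2 ^ (-((d : ℝ) / 2)))
    refine h.congr ?_
    filter_upwards [ae_restrict_mem measurableSet_Ioi] with τ hτ
    have : (0 : ℝ) < τ := hT.trans hτ
    rw [Real.mul_rpow (by norm_num) this.le]
  have e1 : ∫ τ, u τ * arcKernel ε d w τ = (∫ τ in Iic (-T), u τ * arcKernel ε d w τ) +
      (∫ τ in Ioo (-T) T, u τ * arcKernel ε d w τ) + ∫ τ in Ioi T, u τ * arcKernel ε d w τ := by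
    rw [← intervalIntegral.integral_Iic_add_Ioi (b := T) hint.integrableOn hint.integrableOn,
      ← Iic_union_Ioc_eq_Iic (show -T ≤ T by linarith),
      setIntegral_union (Iic_disjoint_Ioc le_rfl) measurableSet_Ioc hint.integrableOn
        hint.integrableOn, integral_Ioc_eq_integral_Ioo]
  have h1 : ‖∫ τ in Iic (-T), u τ * arcKernel ε d w τ‖ ≤ (2 * T) ^ (1 - (d : ℝ) / 2) / 2 := by
    rw [← neg_neg T, ← integral_comp_neg_Ioi, neg_neg]
    refine (norm_integral_le_of_norm_le hIi ?_).trans hI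
    filter_upwards [ae_restrict_mem measurableSet_Ioi] with τ hτ
    have : (0 : ℝ) < τ := hT.trans hτ
    have := hker (-τ) (neg_ne_zero.2 this.ne')
    rwa [abs_neg, abs_of_pos ‹0 < τ›] at this
  have h2 : ‖∫ τ in Ioi T, u τ * arcKernel ε d w τ‖ ≤ (2 * T) ^ (1 - (d : ℝ) / 2) / 2 := by
    refine (norm_integral_le_of_norm_le hIi ?_).trans hI
    filter_upwards [ae_restrict_mem measurableSet_Ioi] with τ hτ
    have : (0 : ℝ) < τ := hT.trans hτ
    have := hker τ this.ne'
    rwa [abs_of_pos ‹0 < τ›] at this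
  rw [e1]
  calc _ = ‖(∫ τ in Iic (-T), u τ * arcKernel ε d w τ) + ∫ τ in Ioi T, u τ * arcKernel ε d w τ‖ := by
        congr 1; ring
    _ ≤ _ := by
        refine (norm_add_le _ _).trans ?_
        linarith

/-! ### The circle method with weighted denominators -/

/-- The squared distance between `ξ` and the nearest rational point with denominator `q`. -/
noncomputable def freqSq {d : ℕ} (ξ : Fin d → ℝ) (q : ℕ) : ℝ :=
  ∑ i, ((nearest (fun i => (q : ℝ) * ξ i) i : ℝ) / q - ξ i) ^ 2

theorem freqSq_nonneg {d : ℕ} (ξ : Fin d → ℝ) (q : ℕ) : 0 ≤ freqSq ξ q :=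
  Finset.sum_nonneg fun _ _ => sq_nonneg _

theorem arcMain_eq (lam : ℕ) {d : ℕ} (ξ : Fin d → ℝ) (p q : ℕ) (hq : 0 < q) :
    arcMain lam ξ p q = (Ioo (-arcRadius lam q) (arcRadius lam q)).indicator (fun τ =>
      gaussG d p q (nearest fun i => (q : ℝ) * ξ i) *
        arcKernel (1 / (lam : ℝ)) d (freqSq ξ q) τ) := by
  funext τ
  rw [arcMain]
  congr 1
  funext τ
  exact prod_thetaTerm_eq (1 / (lam : ℝ)) τ ξ p q hq (nearest fun i => (q : ℝ) * ξ i)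

theorem integrable_arcMain {lam : ℕ} (hlam : 0 < lam) {d : ℕ} (hd : 3 ≤ d) (ξ : Fin d → ℝ)
    (p q : ℕ) (hq : 0 < q) : Integrable (arcMain lam ξ p q) := by
  have hL : (0 : ℝ) < lam := by exact_mod_cast hlam
  rw [arcMain_eq lam ξ p q hq]
  exact ((integrable_arcKernel (by positivity) hd (freqSq_nonneg ξ q)).const_mul _).indicator
    measurableSet_Ioo

theorem mem_Ioc_of_abs_sub_lt {lam : ℕ} {α : ℝ} {p q : ℕ}
    (hq : q ∈ Finset.Icc 1 (Nat.sqrt lam)) (hp : p ∈ numerators q)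
    (h : |α - (p : ℝ) / q| < arcRadius lam q) :
    α ∈ Ioc (1 / (2 * (Nat.sqrt lam : ℝ))) (1 / (2 * (Nat.sqrt lam : ℝ)) + 1) := by
  rw [Finset.mem_Icc] at hq
  have hp' := Finset.mem_Icc.1 (Finset.mem_filter.1 hp).1
  have a1 : (1 : ℝ) ≤ q := by exact_mod_cast hq.1
  have a3 : (q : ℝ) ≤ Nat.sqrt lam := by exact_mod_cast hq.2
  have b1 : (1 : ℝ) ≤ p := by exact_mod_cast hp'.1
  have b2 : (p : ℝ) ≤ q := by exact_mod_cast hp'.2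
  set N : ℝ := (Nat.sqrt lam : ℝ) with hN
  have a4 : 1 ≤ N := a1.trans a3
  have hr : arcRadius lam q ≤ 1 / (2 * N) := by
    rw [arcRadius]
    apply one_div_le_one_div_of_le (by positivity)
    nlinarith
  have hr2 : arcRadius lam q + 1 / (2 * N) ≤ 1 / q := by
    rw [arcRadius, ← hN, div_add_div _ _ (by positivity) (by positivity),
      div_le_div_iff₀ (by positivity) (by positivity)]
    have h1 : 0 ≤ 2 * (q : ℝ) * N * (N - q) := by
      have : 0 ≤ N - q := by linarith
      positivity
    have h2 : 0 ≤ 2 * (q : ℝ) * N * (N - 1) := by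
      have : 0 ≤ N - 1 := by linarith
      positivity
    nlinarith
  have h1 : 1 / (q : ℝ) ≤ p / q := by gcongr
  have h2 : (p : ℝ) / q ≤ 1 := by
    rw [div_le_one (by linarith)]; exact b2
  rw [abs_lt] at h
  constructor <;> linarith

theorem exp_twist_split (lam p q : ℕ) (τ : ℝ) :
    Complex.exp (-(2 * Real.pi * Complex.I * ((lam : ℝ) * (τ + (p : ℝ) / q) : ℝ))) =
      twist lam p q * Complex.exp (-(2 * Real.pi * Complex.I * ((lam : ℝ) * τ : ℝ))) := by
  rw [twist, ← Complex.exp_add]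
  congr 1
  push_cast
  ring

theorem integral_arcMain {lam : ℕ} {d : ℕ} (ξ : Fin d → ℝ)
    {p q : ℕ} (hq : q ∈ Finset.Icc 1 (Nat.sqrt lam)) (hp : p ∈ numerators q) (A : ℂ) :
    ∫ α in (1 / (2 * (Nat.sqrt lam : ℝ)))..(1 / (2 * (Nat.sqrt lam : ℝ)) + 1),
      A * Complex.exp (-(2 * Real.pi * Complex.I * ((lam : ℝ) * α : ℝ))) *
        arcMain lam ξ p q (α - (p : ℝ) / q) =
    twist lam p q * gaussG d p q (nearest fun i => (q : ℝ) * ξ i) *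
      (A * ∫ τ in Ioo (-arcRadius lam q) (arcRadius lam q),
        Complex.exp (-(2 * Real.pi * Complex.I * ((lam : ℝ) * τ : ℝ))) *
        arcKernel (1 / (lam : ℝ)) d (freqSq ξ q) τ) := by
  have hq0 : 0 < q := (Finset.mem_Icc.1 hq).1
  rw [intervalIntegral.integral_of_le (by linarith), setIntegral_eq_integral_of_forall_compl_eq_zero]
  · rw [← integral_add_right_eq_self _ ((p : ℝ) / q)]
    simp_rw [add_sub_cancel_right, exp_twist_split]
    rw [← integral_const_mul, ← integral_const_mul, ← integral_indicator measurableSet_Ioo]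
    congr 1
    funext τ
    rw [arcMain_eq lam ξ p q hq0]
    by_cases hτ : τ ∈ Ioo (-arcRadius lam q) (arcRadius lam q)
    · rw [indicator_of_mem hτ, indicator_of_mem hτ]
      ring
    · rw [indicator_of_notMem hτ, indicator_of_notMem hτ, mul_zero]
  · intro α hα
    rw [arcMain, indicator_of_notMem, mul_zero]
    intro hmem
    rw [mem_Ioo_neg_iff_abs_lt] at hmem
    exact hα (mem_Ioc_of_abs_sub_lt hq hp hmem)

theorem norm_exp_two_pi_mul_one_div {lam : ℕ} (hlam : 0 < lam) :
    ‖Complex.exp (2 * Real.pi * (1 / (lam : ℝ) : ℝ) * lam)‖ = Real.exp (2 * Real.pi) := by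
  rw [Complex.norm_exp]
  congr 1
  have : (2 * Real.pi * (1 / (lam : ℝ) : ℝ) * lam : ℂ) = ((2 * Real.pi : ℝ) : ℂ) := by
    have : (lam : ℂ) ≠ 0 := by exact_mod_cast hlam.ne'
    push_cast
    field_simp
  rw [this, Complex.ofReal_re]

/-- Completion of the singular integral on one arc. -/
theorem norm_arc_sub_singular_le {lam : ℕ} (hlam : 0 < lam) {d : ℕ} (hd : 4 ≤ d) (ξ : Fin d → ℝ)
    {p q : ℕ} (hq : q ∈ Finset.Icc 1 (Nat.sqrt lam)) (hp : p ∈ numerators q) :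
    ‖twist lam p q * gaussG d p q (nearest fun i => (q : ℝ) * ξ i) *
      (Complex.exp (2 * Real.pi * (1 / (lam : ℝ) : ℝ) * lam) *
        ∫ τ in Ioo (-arcRadius lam q) (arcRadius lam q),
        Complex.exp (-(2 * Real.pi * Complex.I * ((lam : ℝ) * τ : ℝ))) *
        arcKernel (1 / (lam : ℝ)) d (freqSq ξ q) τ) -
      twist lam p q * gaussG d p q (nearest fun i => (q : ℝ) * ξ i) *
      ((1 / 2 : ℂ) * (((lam : ℝ) ^ ((d : ℝ) / 2 - 1) : ℝ) : ℂ) * surfaceFourier d (fun i =>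
          √lam * ((nearest (fun i => (q : ℝ) * ξ i) i : ℝ) / q - ξ i)))‖ ≤
      Real.exp (2 * Real.pi) * √2 ^ d * (Nat.sqrt lam : ℝ) ^ ((d : ℝ) / 2 - 1) / q := by
  have hL : (0 : ℝ) < lam := by exact_mod_cast hlam
  have hq0 : 0 < q := (Finset.mem_Icc.1 hq).1
  have hq' : (0 : ℝ) < q := by exact_mod_cast hq0
  have hN0 : (0 : ℝ) < Nat.sqrt lam := by exact_mod_cast Nat.sqrt_pos.2 hlam
  have hε : 0 < 1 / (lam : ℝ) := by positivity
  set A := Complex.exp (2 * Real.pi * (1 / (lam : ℝ) : ℝ) * lam) with hA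
  set u : ℝ → ℂ := fun τ => Complex.exp (-(2 * Real.pi * Complex.I * ((lam : ℝ) * τ : ℝ))) with hu
  have hfull := integral_arcKernel hε (d := d) (by omega)
    (fun i => (nearest (fun i => (q : ℝ) * ξ i) i : ℝ) / q - ξ i) hL
  change ∫ τ : ℝ, A * u τ * arcKernel (1 / (lam : ℝ)) d (freqSq ξ q) τ = _ at hfull
  simp_rw [mul_assoc A] at hfull
  rw [integral_const_mul] at hfull
  rw [← hfull, ← mul_sub, ← mul_sub, norm_mul, norm_mul, norm_mul]
  have hAn : ‖A‖ = Real.exp (2 * Real.pi) := norm_exp_two_pi_mul_one_div hlam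
  have htail := norm_setIntegral_compl_arc_le hε hd (freqSq_nonneg ξ q) (arcRadius_pos hlam hq0) u
    (fun τ => (norm_exp_neg_two_pi_I_mul _).le) (by simp only [hu]; fun_prop)
  rw [norm_sub_rev] at htail
  have htw : ‖twist lam p q‖ = 1 := norm_exp_neg_two_pi_I_mul _
  have hg := norm_gaussG_le d p q hq0 (Finset.mem_filter.1 hp).2
    (nearest fun i => (q : ℝ) * ξ i)
  rw [htw, one_mul, hAn]
  have e1 : (2 * arcRadius lam q) ^ (1 - (d : ℝ) / 2) =
      (q : ℝ) ^ ((d : ℝ) / 2 - 1) * (Nat.sqrt lam : ℝ) ^ ((d : ℝ) / 2 - 1) := by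
    rw [← Real.mul_rpow hq'.le hN0.le, arcRadius, show 1 - (d : ℝ) / 2 = -((d : ℝ) / 2 - 1) by ring,
      Real.rpow_neg (by positivity), ← Real.inv_rpow (by positivity)]
    congr 1
    field_simp
  have e2 : (√2 * (q : ℝ) ^ (-(1 / 2) : ℝ)) ^ d = √2 ^ d * (q : ℝ) ^ (-((d : ℝ) / 2)) := by
    rw [mul_pow, ← Real.rpow_natCast ((q : ℝ) ^ _), ← Real.rpow_mul hq'.le]
    congr 2; ring
  rw [e1] at htail
  rw [e2] at hg
  calc _ ≤ √2 ^ d * (q : ℝ) ^ (-((d : ℝ) / 2)) * (Real.exp (2 * Real.pi) *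
        ((q : ℝ) ^ ((d : ℝ) / 2 - 1) * (Nat.sqrt lam : ℝ) ^ ((d : ℝ) / 2 - 1))) := by
        gcongr
    _ = Real.exp (2 * Real.pi) * √2 ^ d * (Nat.sqrt lam : ℝ) ^ ((d : ℝ) / 2 - 1) *
        ((q : ℝ) ^ (-((d : ℝ) / 2)) * (q : ℝ) ^ ((d : ℝ) / 2 - 1)) := by ring
    _ = _ := by
        rw [← Real.rpow_add hq', show -((d : ℝ) / 2) + ((d : ℝ) / 2 - 1) = -1 by ring,
          Real.rpow_neg_one]
        ring

/-- The sum over the major arcs, taken at the integer vector nearest to `q ξ`, with a weight `w q`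
attached to each denominator. -/
noncomputable def weightedMajor (d lam : ℕ) (ξ : Fin d → ℝ) (w : ℕ → ℂ) : ℂ :=
  ∑ q ∈ Finset.Icc 1 (Nat.sqrt lam), ∑ p ∈ numerators q, w q *
    (twist lam p q * gaussG d p q (nearest fun i => (q : ℝ) * ξ i) *
      ((1 / 2 : ℂ) * (((lam : ℝ) ^ ((d : ℝ) / 2 - 1) : ℝ) : ℂ) * surfaceFourier d (fun i =>
          √lam * ((nearest (fun i => (q : ℝ) * ξ i) i : ℝ) / q - ξ i))))

theorem card_numerators_le (q : ℕ) : ((numerators q).card : ℝ) ≤ q := by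
  have h : (numerators q).card ≤ q := (Finset.card_filter_le _ _).trans (by simp)
  exact_mod_cast h

/-- The absolute base of the error term of the circle method. -/
noncomputable def errorBase : ℝ := 2 * Real.exp (2 * Real.pi) * arcConst

theorem errorBase_pos : 0 < errorBase := by
  have := arcConst_pos
  rw [errorBase]; positivity

/-- The circle method with weighted denominators. The error on the arcs is integrated over an interval
of length one; completing the singular integrals costs at most
`e^{2π} 2^{d/2} N^{d/2-1}` for each of the `N` denominators. -/
theorem norm_wHat_sub_weightedMajor_le {d lam : ℕ} (hd : 5 ≤ d) (hlam : 0 < lam) (ξ : Fin d → ℝ)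
    (w : ℕ → ℂ) (hw : ∀ q, ‖w q‖ ≤ 1)
    (hw1 : ∀ q : ℕ, (∀ i, |q * ξ i - round (q * ξ i)| ≤ 1 / 8) → w q = 1) :
    ‖wHat d lam ξ - weightedMajor d lam ξ w‖ ≤
      errorBase ^ d * ((d : ℝ) * lam) ^ ((d : ℝ) / 4) := by
  have hL : (0 : ℝ) < lam := by exact_mod_cast hlam
  have hε : 0 < 1 / (lam : ℝ) := by positivity
  have hd' : (5 : ℝ) ≤ d := by exact_mod_cast hd
  have hN0 : (0 : ℝ) < Nat.sqrt lam := by exact_mod_cast Nat.sqrt_pos.2 hlam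
  set N := Nat.sqrt lam with hN
  set c : ℝ := 1 / (2 * (N : ℝ)) with hc
  set A := Complex.exp (2 * Real.pi * (1 / (lam : ℝ) : ℝ) * lam) with hA
  set u : ℝ → ℂ := fun α => A * Complex.exp (-(2 * Real.pi * Complex.I * ((lam : ℝ) * α : ℝ)))
    with hu
  have hAn : ‖A‖ = Real.exp (2 * Real.pi) := norm_exp_two_pi_mul_one_div hlam
  have hun : ∀ α, ‖u α‖ = Real.exp (2 * Real.pi) := by
    intro α
    simp only [hu]
    rw [norm_mul, hAn, norm_exp_neg_two_pi_I_mul, mul_one]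
  have huc : Continuous u := by
    simp only [hu]; fun_prop
  have hint : ∀ q ∈ Finset.Icc 1 N, ∀ p ∈ numerators q,
      IntervalIntegrable (fun α => w q * (u α * arcMain lam ξ p q (α - (p : ℝ) / q))) volume
        c (c + 1) := by
    intro q hq p hp
    have h1 := (integrable_arcMain hlam (d := d) (by omega) ξ p q
      (Finset.mem_Icc.1 hq).1).comp_sub_right ((p : ℝ) / q)
    have h2 := h1.bdd_mul huc.aestronglyMeasurable
      (Filter.Eventually.of_forall fun α => (hun α).le)
    exact (h2.const_mul (w q)).intervalIntegrable
  have hint1 : ∀ q ∈ Finset.Icc 1 N, IntervalIntegrable (fun α => ∑ p ∈ numerators q,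
      w q * (u α * arcMain lam ξ p q (α - (p : ℝ) / q))) volume c (c + 1) := by
    intro q hq
    refine (IntervalIntegrable.sum (numerators q) (hint q hq)).congr fun α _ => ?_
    simp
  set main : ℝ → ℂ := fun α => ∑ q ∈ Finset.Icc 1 N, ∑ p ∈ numerators q,
      w q * (u α * arcMain lam ξ p q (α - (p : ℝ) / q)) with hmain
  have hmainint : IntervalIntegrable main volume c (c + 1) := by
    have h := IntervalIntegrable.sum (Finset.Icc 1 N) hint1
    refine h.congr fun α _ => ?_
    simp [hmain]
  have hFc : Continuous fun α => u α * ∏ i, theta (1 / (lam : ℝ)) α (ξ i) :=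
    huc.mul (continuous_finsetProd _ fun i _ => continuous_theta hε (ξ i))
  have hW : wHat d lam ξ = ∫ α in c..(c + 1), u α * ∏ i, theta (1 / (lam : ℝ)) α (ξ i) :=
    wHat_eq_integral hε d lam ξ c
  have hM : ∫ α in c..(c + 1), main α = ∑ q ∈ Finset.Icc 1 N, ∑ p ∈ numerators q, w q *
      (twist lam p q * gaussG d p q (nearest fun i => (q : ℝ) * ξ i) *
      (A * ∫ τ in Ioo (-arcRadius lam q) (arcRadius lam q),
        Complex.exp (-(2 * Real.pi * Complex.I * ((lam : ℝ) * τ : ℝ))) *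
        arcKernel (1 / (lam : ℝ)) d (freqSq ξ q) τ)) := by
    simp only [hmain]
    rw [intervalIntegral.integral_finsetSum hint1]
    refine Finset.sum_congr rfl fun q hq => ?_
    rw [intervalIntegral.integral_finsetSum (hint q hq)]
    refine Finset.sum_congr rfl fun p hp => ?_
    rw [intervalIntegral.integral_const_mul]
    congr 1
    exact integral_arcMain ξ hq hp A
  have h1 : ‖wHat d lam ξ - ∫ α in c..(c + 1), main α‖ ≤
      Real.exp (2 * Real.pi) * (arcConst ^ d * (d * (lam : ℝ)) ^ ((d : ℝ) / 4)) := by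
    rw [hW, ← intervalIntegral.integral_sub (hFc.intervalIntegrable _ _) hmainint]
    refine (intervalIntegral.norm_integral_le_of_norm_le_const fun α hα => ?_).trans
      (le_of_eq (by rw [add_sub_cancel_left, abs_one, mul_one]))
    rw [uIoc_of_le (by linarith)] at hα
    have e : u α * ∏ i, theta (1 / (lam : ℝ)) α (ξ i) - main α =
        u α * (∏ i, theta (1 / (lam : ℝ)) α (ξ i) -
          ∑ q ∈ Finset.Icc 1 N, ∑ p ∈ numerators q,
            w q * arcMain lam ξ p q (α - (p : ℝ) / q)) := by
      rw [mul_sub, Finset.mul_sum]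
      congr 1
      refine Finset.sum_congr rfl fun q _ => ?_
      rw [Finset.mul_sum]
      exact Finset.sum_congr rfl fun p _ => by ring
    rw [e, norm_mul, hun]
    gcongr
    exact norm_prod_theta_sub_arcs_le (by omega) hlam ξ w hw hw1 (Ioc_subset_Icc_self hα)
  have h2 : ‖(∫ α in c..(c + 1), main α) - weightedMajor d lam ξ w‖ ≤
      Real.exp (2 * Real.pi) * √2 ^ d * (lam : ℝ) ^ ((d : ℝ) / 4) := by
    rw [hM, weightedMajor, ← Finset.sum_sub_distrib]
    have hq1 : ∀ q ∈ Finset.Icc 1 N, ‖(∑ p ∈ numerators q, w q *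
      (twist lam p q * gaussG d p q (nearest fun i => (q : ℝ) * ξ i) *
      (A * ∫ τ in Ioo (-arcRadius lam q) (arcRadius lam q),
        Complex.exp (-(2 * Real.pi * Complex.I * ((lam : ℝ) * τ : ℝ))) *
        arcKernel (1 / (lam : ℝ)) d (freqSq ξ q) τ))) - ∑ p ∈ numerators q, w q *
      (twist lam p q * gaussG d p q (nearest fun i => (q : ℝ) * ξ i) *
      ((1 / 2 : ℂ) * (((lam : ℝ) ^ ((d : ℝ) / 2 - 1) : ℝ) : ℂ) * surfaceFourier d (fun i =>
          √lam * ((nearest (fun i => (q : ℝ) * ξ i) i : ℝ) / q - ξ i))))‖ ≤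
        Real.exp (2 * Real.pi) * √2 ^ d * (N : ℝ) ^ ((d : ℝ) / 2 - 1) := by
      intro q hq
      have hq' : (0 : ℝ) < q := by exact_mod_cast (Finset.mem_Icc.1 hq).1
      rw [← Finset.sum_sub_distrib]
      have hp1 : ∀ p ∈ numerators q, ‖w q *
          (twist lam p q * gaussG d p q (nearest fun i => (q : ℝ) * ξ i) *
          (A * ∫ τ in Ioo (-arcRadius lam q) (arcRadius lam q),
            Complex.exp (-(2 * Real.pi * Complex.I * ((lam : ℝ) * τ : ℝ))) *
            arcKernel (1 / (lam : ℝ)) d (freqSq ξ q) τ)) - w q *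
          (twist lam p q * gaussG d p q (nearest fun i => (q : ℝ) * ξ i) *
          ((1 / 2 : ℂ) * (((lam : ℝ) ^ ((d : ℝ) / 2 - 1) : ℝ) : ℂ) * surfaceFourier d (fun i =>
              √lam * ((nearest (fun i => (q : ℝ) * ξ i) i : ℝ) / q - ξ i))))‖ ≤
          Real.exp (2 * Real.pi) * √2 ^ d * (N : ℝ) ^ ((d : ℝ) / 2 - 1) / q := by
        intro p hp
        rw [← mul_sub, norm_mul]
        exact (mul_le_of_le_one_left (norm_nonneg _) (hw q)).trans
          (norm_arc_sub_singular_le hlam (by omega) ξ hq hp)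
      refine (norm_sum_le_of_le _ hp1).trans ?_
      rw [Finset.sum_const, nsmul_eq_mul]
      have h0 : 0 ≤ Real.exp (2 * Real.pi) * √2 ^ d * (N : ℝ) ^ ((d : ℝ) / 2 - 1) := by positivity
      calc _ ≤ (q : ℝ) * (Real.exp (2 * Real.pi) * √2 ^ d * (N : ℝ) ^ ((d : ℝ) / 2 - 1) / q) := by
            exact mul_le_mul_of_nonneg_right (card_numerators_le q) (by positivity)
        _ = _ := by field_simp
    refine (norm_sum_le_of_le _ hq1).trans ?_
    rw [Finset.sum_const, Nat.card_Icc, nsmul_eq_mul, Nat.add_sub_cancel]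
    -- there are `N` denominators, and `N · N ^ (d / 2 - 1) = (N²) ^ (d / 4)` with `N² ≤ lam`
    have e : (N : ℝ) * (N : ℝ) ^ ((d : ℝ) / 2 - 1) = ((N : ℝ) ^ 2) ^ ((d : ℝ) / 4) := by
      rw [← Real.rpow_natCast, ← Real.rpow_mul hN0.le]
      nth_rewrite 1 [← Real.rpow_one (N : ℝ)]
      rw [← Real.rpow_add hN0]
      congr 1
      push_cast; ring
    have hNL : (N : ℝ) ^ 2 ≤ lam := by
      have := Nat.sqrt_le' lam
      exact_mod_cast this
    calc _ = Real.exp (2 * Real.pi) * √2 ^ d * ((N : ℝ) * (N : ℝ) ^ ((d : ℝ) / 2 - 1)) := by ring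
      _ ≤ _ := by
        rw [e]
        gcongr
  have h3 : √2 ^ d * (lam : ℝ) ^ ((d : ℝ) / 4) ≤ arcConst ^ d * (d * (lam : ℝ)) ^ ((d : ℝ) / 4) := by
    have hC := tailConst_nonneg
    gcongr
    · have := arcConst_pos
      positivity
    · rw [arcConst]
      have : 0 ≤ √2 * tailConst := by positivity
      have : 0 ≤ √2 := by positivity
      linarith
    · exact le_mul_of_one_le_left hL.le (by linarith)
  have h4 : 2 * Real.exp (2 * Real.pi) ≤ (2 * Real.exp (2 * Real.pi)) ^ d := by
    refine le_self_pow₀ ?_ (by omega)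
    have : 1 ≤ Real.exp (2 * Real.pi) := Real.one_le_exp (by positivity)
    linarith
  have h5 : 0 ≤ arcConst ^ d * (d * (lam : ℝ)) ^ ((d : ℝ) / 4) := by
    have := arcConst_pos
    positivity
  calc _ ≤ ‖wHat d lam ξ - ∫ α in c..(c + 1), main α‖ +
        ‖(∫ α in c..(c + 1), main α) - weightedMajor d lam ξ w‖ :=
          norm_sub_le_norm_sub_add_norm_sub _ _ _
    _ ≤ Real.exp (2 * Real.pi) * (arcConst ^ d * (d * (lam : ℝ)) ^ ((d : ℝ) / 4)) +
        Real.exp (2 * Real.pi) * (arcConst ^ d * (d * (lam : ℝ)) ^ ((d : ℝ) / 4)) := by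
        refine add_le_add h1 (h2.trans ?_)
        rw [mul_assoc]
        gcongr
    _ = 2 * Real.exp (2 * Real.pi) * (arcConst ^ d * (d * (lam : ℝ)) ^ ((d : ℝ) / 4)) := by ring
    _ ≤ (2 * Real.exp (2 * Real.pi)) ^ d * (arcConst ^ d * (d * (lam : ℝ)) ^ ((d : ℝ) / 4)) := by
        gcongr
    _ = _ := by rw [errorBase, mul_pow _ arcConst]; ring

/-! ### The two major arc terms -/

theorem IsCutoff.eq_zero {φ : ℝ → ℂ} (hφ : IsCutoff φ) {t : ℝ} (ht : 1 / 4 ≤ |t|) : φ t = 0 := by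
  by_contra h
  have h1 := hφ.tsupport_subset (subset_tsupport φ h)
  rw [mem_Ioo, ← abs_lt] at h1
  linarith

theorem norm_tensorCutoff_le {φ : ℝ → ℂ} (hφ : IsCutoff φ) {d : ℕ} (y : Fin d → ℝ) :
    ‖tensorCutoff φ y‖ ≤ 1 := by
  rw [tensorCutoff, norm_prod]
  exact Finset.prod_le_one (fun _ _ => norm_nonneg _) fun i _ => hφ.norm_le_one _

theorem tensorCutoff_eq_one {φ : ℝ → ℂ} (hφ : IsCutoff φ) {d : ℕ} {y : Fin d → ℝ}
    (hy : ∀ i, |y i| ≤ 1 / 8) : tensorCutoff φ y = 1 := by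
  rw [tensorCutoff]
  refine Finset.prod_eq_one fun i _ => hφ.eq_one _ ?_
  rw [mem_Icc, ← abs_le]
  exact hy i

theorem tensorCutoff_sub_eq_zero {φ : ℝ → ℂ} (hφ : IsCutoff φ) {d : ℕ} {y : Fin d → ℝ}
    {x : Fin d → ℤ} (hx : x ≠ nearest y) : tensorCutoff φ (fun i => y i - (x i : ℝ)) = 0 := by
  obtain ⟨i, hi⟩ := Function.ne_iff.1 hx
  rw [tensorCutoff]
  refine Finset.prod_eq_zero (Finset.mem_univ i) (hφ.eq_zero ?_)
  by_contra hlt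
  push Not at hlt
  have h1 : |y i - round (y i)| ≤ 1 / 2 := abs_sub_round (y i)
  have h2 : |((round (y i) - x i : ℤ) : ℝ)| < 1 := by
    push_cast
    have := abs_sub_le (round (y i) : ℝ) (y i) (x i)
    rw [abs_sub_comm (round (y i) : ℝ) (y i)] at this
    linarith
  have h3 : round (y i) - x i = 0 := by
    rw [← Int.abs_lt_one_iff]
    exact_mod_cast h2
  exact hi (by rw [nearest]; omega)

/-- The weight of the denominator `q` in the two major arc terms taken together. -/
noncomputable def cutoffWeight (φ : ℝ → ℂ) (n : ℕ) {d : ℕ} (ξ : Fin d → ℝ) (q : ℕ) : ℂ :=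
  if q < n then 1 else tensorCutoff φ fun i =>
    (q : ℝ) * ξ i - (nearest (fun i => (q : ℝ) * ξ i) i : ℝ)

theorem majorOne_add_majorTwo {φ : ℝ → ℂ} (hφ : IsCutoff φ) (d lam n : ℕ) (ξ : Fin d → ℝ) :
    majorOne d lam n ξ + majorTwo φ d lam n ξ =
      weightedMajor d lam ξ (cutoffWeight φ n ξ) := by
  rw [majorOne, majorTwo, weightedMajor, ← mul_add, Finset.sum_filter, Finset.sum_filter,
    ← Finset.sum_add_distrib, Finset.mul_sum]
  refine Finset.sum_congr rfl fun q _ => ?_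
  by_cases hqn : q < n
  · rw [if_pos hqn, if_neg (by omega), add_zero, Finset.mul_sum]
    refine Finset.sum_congr rfl fun p _ => ?_
    rw [cutoffWeight, if_pos hqn]
    ring
  · rw [if_neg hqn, if_pos (by omega), zero_add, Finset.mul_sum]
    refine Finset.sum_congr rfl fun p _ => ?_
    rw [tsum_eq_single (nearest fun i => (q : ℝ) * ξ i), cutoffWeight, if_neg hqn]
    · ring
    · intro x hx
      rw [tensorCutoff_sub_eq_zero hφ hx]
      ring

theorem majorOne_eq_weightedMajor (d lam : ℕ) (ξ : Fin d → ℝ) :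
    majorOne d lam (Nat.sqrt lam + 1) ξ = weightedMajor d lam ξ fun _ => 1 := by
  rw [majorOne, weightedMajor, Finset.filter_true_of_mem, Finset.mul_sum]
  · refine Finset.sum_congr rfl fun q _ => ?_
    rw [Finset.mul_sum]
    exact Finset.sum_congr rfl fun p _ => by ring
  · intro q hq
    exact Nat.lt_succ_of_le (Finset.mem_Icc.1 hq).2

theorem norm_wHat_sub_major_le {d lam : ℕ} (hd : 5 ≤ d) (hlam : 0 < lam) {φ : ℝ → ℂ}
    (hφ : IsCutoff φ) (n : ℕ) (ξ : Fin d → ℝ) :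
    ‖wHat d lam ξ - majorOne d lam n ξ - majorTwo φ d lam n ξ‖ ≤
      errorBase ^ d * ((d : ℝ) * lam) ^ ((d : ℝ) / 4) := by
  rw [sub_sub, majorOne_add_majorTwo hφ]
  refine norm_wHat_sub_weightedMajor_le hd hlam ξ _ (fun q => ?_) fun q hq => ?_
  · rw [cutoffWeight]
    split_ifs
    · simp
    · exact norm_tensorCutoff_le hφ _
  · rw [cutoffWeight]
    split_ifs
    · rfl
    · exact tensorCutoff_eq_one hφ hq

theorem norm_wHat_sub_majorOne_le {d lam : ℕ} (hd : 5 ≤ d) (hlam : 0 < lam) (ξ : Fin d → ℝ) :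
    ‖wHat d lam ξ - majorOne d lam (Nat.sqrt lam + 1) ξ‖ ≤
      errorBase ^ d * ((d : ℝ) * lam) ^ ((d : ℝ) / 4) := by
  rw [majorOne_eq_weightedMajor]
  exact norm_wHat_sub_weightedMajor_le hd hlam ξ _ (fun q => by simp) fun q _ => rfl

/-! ### The singular series -/

theorem gaussOne_one_two_zero : gaussOne 1 2 0 = 0 := by
  rw [gaussOne, Finset.sum_range_succ, Finset.sum_range_one]
  have : (2 * Real.pi * Complex.I *
      (((((1 : ℕ) : ℤ) ^ 2 * 1 + 0 * ((1 : ℕ) : ℤ) : ℤ)) : ℂ) / ((2 : ℕ) : ℂ)) =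
      Real.pi * Complex.I := by
    push_cast; ring
  rw [this, Complex.exp_pi_mul_I]
  simp

theorem singularTerm_two {d : ℕ} (hd : 0 < d) (lam : ℕ) : singularTerm d lam 2 = 0 := by
  refine Finset.sum_eq_zero fun p hp => ?_
  have h := Finset.mem_filter.1 hp
  have h1 := Finset.mem_Icc.1 h.1
  have hp1 : p = 1 := by
    have h2 : p ≠ 2 := by
      rintro rfl
      exact absurd h.2 (by decide)
    omega
  rw [hp1, gaussG_eq_prod d 1 2 (by norm_num),
    Finset.prod_eq_zero (Finset.mem_univ (⟨0, hd⟩ : Fin d)), mul_zero]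
  exact_mod_cast gaussOne_one_two_zero

theorem singularTerm_zero (d lam : ℕ) : singularTerm d lam 0 = 0 := by
  simp [singularTerm, numerators]

theorem singularTerm_one (d lam : ℕ) : singularTerm d lam 1 = 1 := by
  have h : numerators 1 = {1} := by decide
  have h1 : ∀ i, gaussOne (1 : ℕ) 1 ((0 : Fin d → ℤ) i) = 1 := by
    intro i
    simp [gaussOne]
  have h2 : twist lam 1 1 = 1 := by
    rw [twist, Complex.exp_eq_one_iff]
    exact ⟨-lam, by push_cast; ring⟩
  rw [singularTerm, h, Finset.sum_singleton, gaussG_eq_prod d 1 1 one_pos, h2,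
    Finset.prod_eq_one fun i _ => h1 i, mul_one]

/-- For `q ≥ 3` this is the trivial bound with Gauss sums of size `√(2/q)`; the denominator `2`, for
which that bound does not decay in the dimension, contributes nothing. -/
theorem norm_singularTerm_le {d : ℕ} (hd : 16 ≤ d) (lam q : ℕ) :
    ‖singularTerm d lam q‖ ≤ 256 * ((q : ℝ) ^ 7)⁻¹ := by
  rcases Nat.lt_or_ge q 3 with hq | hq
  · interval_cases q
    · rw [singularTerm_zero]; simp
    · rw [singularTerm_one]; norm_num
    · rw [singularTerm_two (by omega)]; norm_num
  · have hq' : (3 : ℝ) ≤ q := by exact_mod_cast hq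
    have h1 : √2 * (q : ℝ) ^ (-(1 / 2) : ℝ) ≤ 1 := by
      rw [Real.rpow_neg (by positivity), ← Real.sqrt_eq_rpow, ← div_eq_mul_inv,
        div_le_one (by positivity)]
      exact Real.sqrt_le_sqrt (by linarith)
    have h2 : (√2 * (q : ℝ) ^ (-(1 / 2) : ℝ)) ^ d ≤ (2 / q) ^ 8 := by
      refine (pow_le_pow_of_le_one (by positivity) h1 hd).trans (le_of_eq ?_)
      have : (√2 * (q : ℝ) ^ (-(1 / 2) : ℝ)) ^ 2 = 2 / q := by
        rw [mul_pow, Real.sq_sqrt (by norm_num), ← Real.rpow_natCast, ← Real.rpow_mul (by positivity)]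
        norm_num
        rw [Real.rpow_neg_one, div_eq_mul_inv]
      rw [← this, ← pow_mul]
    have h3 : ∀ p ∈ numerators q, ‖twist lam p q * gaussG d p q 0‖ ≤ (2 / q) ^ 8 := by
      intro p hp
      rw [norm_mul, show ‖twist lam p q‖ = 1 from norm_exp_neg_two_pi_I_mul _, one_mul]
      exact (norm_gaussG_le d p q (by omega) (Finset.mem_filter.1 hp).2 0).trans h2
    refine (norm_sum_le_of_le _ h3).trans ?_
    rw [Finset.sum_const, nsmul_eq_mul]
    refine (mul_le_mul_of_nonneg_right (card_numerators_le q) (by positivity)).trans (le_of_eq ?_)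
    field_simp
    norm_num

theorem summable_norm_singularTerm {d : ℕ} (hd : 16 ≤ d) (lam : ℕ) :
    Summable fun q => ‖singularTerm d lam q‖ := by
  refine Summable.of_nonneg_of_le (fun _ => norm_nonneg _) (norm_singularTerm_le hd lam) ?_
  exact (Real.summable_nat_pow_inv.2 (by norm_num)).mul_left _

theorem norm_singularSeries_sub_partial_le {d : ℕ} (hd : 16 ≤ d) (lam : ℕ) {M : ℕ} (hM : 3 ≤ M) :
    ‖singularSeries d lam - ∑ q ∈ Finset.Icc 1 M, singularTerm d lam q‖ ≤ 1 / (4 * (M : ℝ)) := by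
  have hM' : (3 : ℝ) ≤ M := by exact_mod_cast hM
  have hs := (summable_norm_singularTerm hd lam).of_norm
  have ht := (hs.hasSum.tendsto_sum_nat.comp (Filter.tendsto_add_atTop_nat 1)).sub_const
    (∑ q ∈ Finset.Icc 1 M, singularTerm d lam q)
  refine le_of_tendsto ht.norm ?_
  filter_upwards [Filter.eventually_ge_atTop M] with n hn
  have e : ∑ q ∈ Finset.range (n + 1), singularTerm d lam q =
      ∑ q ∈ Finset.Icc 1 M, singularTerm d lam q + ∑ q ∈ Finset.Ioc M n, singularTerm d lam q := by
    rw [Finset.range_eq_Ico, Finset.sum_eq_sum_Ico_succ_bot (by omega), singularTerm_zero, zero_add]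
    have h1 : Finset.Icc 1 M = Finset.Ico (0 + 1) (M + 1) := by ext; simp
    have h2 : Finset.Ioc M n = Finset.Ico (M + 1) (n + 1) := by ext; simp
    rw [h1, h2, Finset.sum_Ico_consecutive _ (by omega) (by omega)]
  simp only [Function.comp_apply]
  rw [e, add_sub_cancel_left]
  have hb : ∀ q ∈ Finset.Ioc M n, ‖singularTerm d lam q‖ ≤ 1 / 4 * ((q : ℝ) ^ 2)⁻¹ := by
    intro q hq
    have hq4 : (4 : ℝ) ≤ q := by
      have := (Finset.mem_Ioc.1 hq).1
      exact_mod_cast (by omega : 4 ≤ q)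
    refine (norm_singularTerm_le hd lam q).trans ?_
    have h5 : (4 : ℝ) ^ 5 ≤ (q : ℝ) ^ 5 := by gcongr
    -- `256 / q⁷ ≤ (256 / 4⁵) / q²` for `q ≥ 4`
    rw [show (q : ℝ) ^ 7 = q ^ 5 * q ^ 2 by ring, mul_inv, ← mul_assoc]
    gcongr
    rw [← div_eq_mul_inv, div_le_iff₀ (by positivity)]
    linarith
  refine (norm_sum_le_of_le _ hb).trans ?_
  rw [← Finset.mul_sum]
  have h6 := sum_Ioc_inv_sq_le_sub (α := ℝ) (k := M) (n := n) (by omega) hn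
  have h7 : (0 : ℝ) ≤ (n : ℝ)⁻¹ := by positivity
  calc _ ≤ 1 / 4 * ((M : ℝ)⁻¹ - (n : ℝ)⁻¹) := by gcongr
    _ ≤ 1 / 4 * (M : ℝ)⁻¹ := by linarith
    _ = _ := by field_simp

theorem norm_singularSeries_sub_one_le {d : ℕ} (hd : 16 ≤ d) (lam : ℕ) :
    ‖singularSeries d lam - 1‖ ≤ 1 / 4 := by
  have h := norm_singularSeries_sub_partial_le hd lam (le_refl 3)
  have e : ∑ q ∈ Finset.Icc 1 3, singularTerm d lam q = 1 + singularTerm d lam 3 := by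
    rw [show Finset.Icc 1 3 = {1, 2, 3} by decide]
    rw [Finset.sum_insert (by decide), Finset.sum_insert (by decide), Finset.sum_singleton,
      singularTerm_one, singularTerm_two (by omega), zero_add]
  have h3 := norm_singularTerm_le hd lam 3
  rw [e] at h
  have := norm_add_le (singularSeries d lam - (1 + singularTerm d lam 3)) (singularTerm d lam 3)
  rw [show singularSeries d lam - (1 + singularTerm d lam 3) + singularTerm d lam 3 =
    singularSeries d lam - 1 by ring] at this
  norm_num at h h3
  linarith

theorem conj_gaussOne (p : ℤ) (q : ℕ) (hq : 0 < q) :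
    (starRingEnd ℂ) (gaussOne p q 0) = gaussOne (q - p) q 0 := by
  have hq' : (q : ℂ) ≠ 0 := by exact_mod_cast hq.ne'
  rw [gaussOne, gaussOne, map_mul, map_inv₀, Complex.conj_natCast, map_sum]
  congr 1
  refine Finset.sum_congr rfl fun n _ => ?_
  rw [← Complex.exp_conj, Complex.exp_eq_exp_iff_exists_int]
  refine ⟨-(n : ℤ) ^ 2, ?_⟩
  simp only [map_div₀, map_mul, Complex.conj_I, Complex.conj_ofReal, Complex.conj_natCast]
  rw [show (starRingEnd ℂ) 2 = 2 from Complex.conj_ofNat 2]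
  simp only [map_intCast]
  push_cast
  field_simp
  ring

/-- Complex conjugation exchanges the fractions `p / q` and `(q - p) / q`. -/
theorem conj_singularTerm (d lam q : ℕ) :
    (starRingEnd ℂ) (singularTerm d lam q) = singularTerm d lam q := by
  rcases Nat.lt_or_ge q 2 with hq | hq
  · interval_cases q
    · simp [singularTerm_zero]
    · simp [singularTerm_one]
  · have hq' : (q : ℂ) ≠ 0 := by exact_mod_cast (by omega : q ≠ 0)
    have hmem : ∀ p ∈ numerators q, q - p ∈ numerators q ∧ p < q := by
      intro p hp
      have h := Finset.mem_filter.1 hp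
      have h1 := Finset.mem_Icc.1 h.1
      have h2 : p ≠ q := by
        rintro rfl
        have := (Nat.coprime_self p).1 h.2
        omega
      have h3 : p < q := by omega
      refine ⟨Finset.mem_filter.2 ⟨Finset.mem_Icc.2 ⟨by omega, by omega⟩, ?_⟩, h3⟩
      exact (Nat.coprime_self_sub_left h1.2).2 h.2
    rw [singularTerm, map_sum]
    refine Finset.sum_nbij' (fun p => q - p) (fun p => q - p) (fun p hp => (hmem p hp).1)
      (fun p hp => (hmem p hp).1) (fun p hp => ?_) (fun p hp => ?_) fun p hp => ?_
    · have := (hmem p hp).2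
      omega
    · have := (hmem p hp).2
      omega
    · have hpq := (hmem p hp).2.le
      rw [map_mul, gaussG_eq_prod d _ q (by omega), gaussG_eq_prod d _ q (by omega), map_prod]
      congr 1
      · rw [twist, twist, ← Complex.exp_conj, Complex.exp_eq_exp_iff_exists_int]
        refine ⟨lam, ?_⟩
        simp only [map_neg, map_mul, Complex.conj_I, Complex.conj_ofReal]
        rw [show (starRingEnd ℂ) 2 = 2 from Complex.conj_ofNat 2]
        push_cast [Nat.cast_sub hpq]
        field_simp
        ring
      · refine Finset.prod_congr rfl fun i _ => ?_
        rw [Pi.zero_apply, conj_gaussOne p q (by omega), Nat.cast_sub hpq]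

theorem singularSeries_im (d lam : ℕ) : (singularSeries d lam).im = 0 := by
  rw [← Complex.conj_eq_iff_im, singularSeries, Complex.conj_tsum]
  simp_rw [conj_singularTerm]

/-! ### Counting lattice points -/

theorem mainTerm_pos {d lam : ℕ} (hd : 0 < d) (hlam : 0 < lam) : 0 < mainTerm d lam := by
  have hL : (0 : ℝ) < lam := by exact_mod_cast hlam
  have hd' : (0 : ℝ) < d := by exact_mod_cast hd
  have := Real.Gamma_pos_of_pos (show 0 < (d : ℝ) / 2 by positivity)
  have := Real.pi_pos
  rw [mainTerm]; positivity

theorem surfaceMeasure_real_univ {d : ℕ} (hd : 0 < d) :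
    (surfaceMeasure d).real Set.univ =
      2 * (Real.pi ^ ((d : ℝ) / 2) / Real.Gamma ((d : ℝ) / 2)) := by
  have hd' : (0 : ℝ) < d := by exact_mod_cast hd
  have : Nonempty (Fin d) := ⟨⟨0, hd⟩⟩
  have hG := Real.Gamma_pos_of_pos (show 0 < (d : ℝ) / 2 by positivity)
  have hG1 : Real.Gamma ((d : ℝ) / 2 + 1) = (d : ℝ) / 2 * Real.Gamma ((d : ℝ) / 2) :=
    Real.Gamma_add_one (by positivity)
  have hpi : √Real.pi ^ d = Real.pi ^ ((d : ℝ) / 2) := by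
    rw [Real.sqrt_eq_rpow, ← Real.rpow_natCast, ← Real.rpow_mul Real.pi_pos.le]
    congr 1; ring
  rw [surfaceMeasure, Measure.toSphere_real_apply_univ, finrank_euclideanSpace, Fintype.card_fin,
    Measure.real, EuclideanSpace.volume_ball]
  simp only [ENNReal.ofReal_one, one_pow, one_mul, Fintype.card_fin]
  rw [hG1, hpi, ENNReal.toReal_ofReal (by have := Real.pi_pos; positivity)]
  field_simp

theorem surfaceFourier_zero (d : ℕ) :
    surfaceFourier d 0 = (((surfaceMeasure d).real Set.univ : ℝ) : ℂ) := by
  simp [surfaceFourier]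

theorem majorOne_at_zero {d : ℕ} (hd : 0 < d) (lam : ℕ) :
    majorOne d lam (Nat.sqrt lam + 1) 0 =
      (mainTerm d lam : ℂ) * ∑ q ∈ Finset.Icc 1 (Nat.sqrt lam), singularTerm d lam q := by
  have hn : ∀ q : ℕ, (nearest fun i : Fin d => (q : ℝ) * (0 : Fin d → ℝ) i) = 0 := by
    intro q
    funext i
    simp [nearest]
  have hm : (mainTerm d lam : ℂ) = (1 / 2 : ℂ) * (((lam : ℝ) ^ ((d : ℝ) / 2 - 1) : ℝ) : ℂ) *
      (((surfaceMeasure d).real Set.univ : ℝ) : ℂ) := by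
    rw [surfaceMeasure_real_univ hd, mainTerm]
    push_cast
    ring
  rw [majorOne_eq_weightedMajor, weightedMajor, Finset.mul_sum]
  refine Finset.sum_congr rfl fun q _ => ?_
  rw [singularTerm, Finset.mul_sum]
  refine Finset.sum_congr rfl fun p _ => ?_
  have h0 : (fun i : Fin d => √(lam : ℝ) * ((((nearest fun i : Fin d => (q : ℝ) *
      (0 : Fin d → ℝ) i) i : ℤ) : ℝ) / q - (0 : Fin d → ℝ) i)) = 0 := by
    funext i
    rw [hn]
    simp
  rw [h0, hn, surfaceFourier_zero, hm]
  ring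

theorem wHat_zero (d lam : ℕ) : wHat d lam 0 = ((latticeSphere d lam).ncard : ℂ) := by
  rw [wHat, Set.ncard_eq_toFinset_card _ (latticeSphere_finite d lam)]
  simp

/-- A crude form of Stirling's bound, by induction along the functional equation in steps of two. -/
theorem Gamma_half_le : ∀ n : ℕ, 0 < n → Real.Gamma ((n : ℝ) / 2) ≤ 2 * (n : ℝ) ^ ((n : ℝ) / 2)
  | 0, h => absurd h (lt_irrefl 0)
  | 1, _ => by
    have h : √Real.pi ≤ 2 := Real.sqrt_le_iff.2 ⟨by norm_num, by linarith [Real.pi_lt_four]⟩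
    have := Real.Gamma_one_half_eq
    norm_num at this ⊢
    rw [this]
    exact h
  | 2, _ => by norm_num
  | n + 3, _ => by
    have ih := Gamma_half_le (n + 1) (Nat.succ_pos n)
    have e : (((n + 3 : ℕ) : ℝ)) / 2 = (((n + 1 : ℕ) : ℝ)) / 2 + 1 := by push_cast; ring
    rw [e, Real.Gamma_add_one (by positivity), Real.rpow_add_one (by positivity)]
    have h1 : (((n + 1 : ℕ) : ℝ)) / 2 ≤ ((n + 3 : ℕ) : ℝ) := by push_cast; linarith
    have h2 : (((n + 1 : ℕ) : ℝ)) ^ ((((n + 1 : ℕ) : ℝ)) / 2) ≤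
        (((n + 3 : ℕ) : ℝ)) ^ ((((n + 1 : ℕ) : ℝ)) / 2) := by
      gcongr
      omega
    calc _ ≤ ((n + 3 : ℕ) : ℝ) * (2 * (((n + 3 : ℕ) : ℝ)) ^ ((((n + 1 : ℕ) : ℝ)) / 2)) := by
          refine mul_le_mul h1 (ih.trans (by gcongr)) ?_ (by positivity)
          exact (Real.Gamma_pos_of_pos (by positivity)).le
      _ = _ := by ring

/-- The constant `C` in the condition `C d³ ≤ lam`. Its size is chosen so that
`C ^ (1 - d / 4)` beats the `d`-th power of `errorBase` for `d ≥ 16`. -/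
noncomputable def radiusConst : ℝ := (8 * (errorBase + 1)) ^ 16

theorem sixteen_le_radiusConst : 16 ≤ radiusConst := by
  have := errorBase_pos
  have h : (2 : ℝ) ^ 16 ≤ radiusConst := by
    rw [radiusConst]
    gcongr
    linarith
  norm_num at h
  linarith

theorem cube_le_two_pow {d : ℕ} (hd : 16 ≤ d) : d ^ 3 ≤ 2 ^ d := by
  induction d, hd using Nat.le_induction with
  | base => norm_num
  | succ n hn ih =>
    rw [pow_succ 2]
    nlinarith [mul_le_mul hn hn (by norm_num) (by omega)]

/-- Once `lam` exceeds a large multiple of `d³`, the error term of the circle method is smaller than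
the main term by a factor `d`. -/
theorem error_le_mainTerm_div {d lam : ℕ} (hd : 16 ≤ d) (hlam : 0 < lam)
    (h : radiusConst * (d : ℝ) ^ 3 ≤ (lam : ℝ)) :
    errorBase ^ d * ((d : ℝ) * lam) ^ ((d : ℝ) / 4) ≤ mainTerm d lam * (1 / d) := by
  have hL : (0 : ℝ) < lam := by exact_mod_cast hlam
  have hd16 : (16 : ℝ) ≤ d := by exact_mod_cast hd
  have hd' : (0 : ℝ) < d := by linarith
  have hK := errorBase_pos
  have hC0 := sixteen_le_radiusConst
  have hG := Gamma_half_le d (by omega)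
  have hGp := Real.Gamma_pos_of_pos (show 0 < (d : ℝ) / 2 by positivity)
  have hpi : 1 ≤ Real.pi ^ ((d : ℝ) / 2) :=
    Real.one_le_rpow (by linarith [Real.pi_gt_three]) (by positivity)
  have h1 : (lam : ℝ) ^ (1 - (d : ℝ) / 4) ≤
      radiusConst ^ (1 - (d : ℝ) / 4) * (d : ℝ) ^ (3 - 3 * (d : ℝ) / 4) := by
    have e : (d : ℝ) ^ (3 - 3 * (d : ℝ) / 4) = ((d : ℝ) ^ 3) ^ (1 - (d : ℝ) / 4) := by
      rw [← Real.rpow_natCast, ← Real.rpow_mul hd'.le]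
      congr 1; push_cast; ring
    rw [e, ← Real.mul_rpow (by linarith) (by positivity)]
    exact Real.rpow_le_rpow_of_nonpos (by positivity) h (by linarith)
  -- for `d ≥ 16` the exponent satisfies `1 - d / 4 ≤ -d / 16`
  have h2 : radiusConst ^ (1 - (d : ℝ) / 4) ≤ ((8 * (errorBase + 1)) ^ d)⁻¹ := by
    have e : ((8 * (errorBase + 1)) ^ d)⁻¹ = radiusConst ^ (-((d : ℝ) / 16)) := by
      rw [radiusConst, ← Real.rpow_natCast (8 * (errorBase + 1)) 16,
        ← Real.rpow_mul (by positivity), ← Real.rpow_natCast, ← Real.rpow_neg (by positivity)]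
      congr 1; push_cast; ring
    rw [e]
    exact Real.rpow_le_rpow_of_exponent_le (by linarith) (by linarith)
  have h3 : errorBase ^ d * ((8 * (errorBase + 1)) ^ d)⁻¹ ≤ ((8 : ℝ) ^ d)⁻¹ := by
    rw [mul_pow, mul_inv, mul_comm ((8 : ℝ) ^ d)⁻¹, ← mul_assoc]
    refine mul_le_of_le_one_left (by positivity) ?_
    rw [← div_eq_mul_inv, div_le_one (by positivity)]
    gcongr
    linarith
  have h4 : (d : ℝ) ^ 3 ≤ 2 ^ d := by exact_mod_cast cube_le_two_pow hd
  have h5 : 2 * (d : ℝ) ≤ 4 ^ d := by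
    have := one_add_mul_le_pow (a := (3 : ℝ)) (by norm_num) d
    norm_num at this
    linarith
  have h6 : 2 * (d : ℝ) * ((d : ℝ) ^ 3 * ((8 : ℝ) ^ d)⁻¹) ≤ 1 := by
    rw [show (8 : ℝ) = 4 * 2 by norm_num, mul_pow, ← div_eq_mul_inv, mul_div_assoc',
      div_le_one (by positivity)]
    gcongr
  have hA : (lam : ℝ) ^ ((d : ℝ) / 4) =
      (lam : ℝ) ^ ((d : ℝ) / 2 - 1) * (lam : ℝ) ^ (1 - (d : ℝ) / 4) := by
    rw [← Real.rpow_add hL]; congr 1; ring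
  have hD : (d : ℝ) ^ ((d : ℝ) / 4) * (d : ℝ) ^ ((d : ℝ) / 2) *
      (d : ℝ) ^ (3 - 3 * (d : ℝ) / 4) = (d : ℝ) ^ 3 := by
    rw [← Real.rpow_add hd', ← Real.rpow_add hd', ← Real.rpow_natCast]
    congr 1; push_cast; ring
  rw [mul_one_div, le_div_iff₀ hd', mainTerm, Real.mul_rpow hd'.le hL.le, hA,
    div_mul_eq_mul_div, le_div_iff₀ hGp]
  calc _ = (lam : ℝ) ^ ((d : ℝ) / 2 - 1) * (d * (errorBase ^ d * (d : ℝ) ^ ((d : ℝ) / 4) *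
          (lam : ℝ) ^ (1 - (d : ℝ) / 4) * Real.Gamma ((d : ℝ) / 2))) := by ring
    _ ≤ (lam : ℝ) ^ ((d : ℝ) / 2 - 1) * (d * (errorBase ^ d * (d : ℝ) ^ ((d : ℝ) / 4) *
          (((8 * (errorBase + 1)) ^ d)⁻¹ * (d : ℝ) ^ (3 - 3 * (d : ℝ) / 4)) *
          (2 * (d : ℝ) ^ ((d : ℝ) / 2)))) := by
        have h7 := h1.trans (mul_le_mul_of_nonneg_right h2
          (show 0 ≤ (d : ℝ) ^ (3 - 3 * (d : ℝ) / 4) by positivity))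
        gcongr
    _ = (lam : ℝ) ^ ((d : ℝ) / 2 - 1) * (2 * d * (((d : ℝ) ^ ((d : ℝ) / 4) *
          (d : ℝ) ^ ((d : ℝ) / 2) * (d : ℝ) ^ (3 - 3 * (d : ℝ) / 4)) *
          (errorBase ^ d * ((8 * (errorBase + 1)) ^ d)⁻¹))) := by ring
    _ ≤ (lam : ℝ) ^ ((d : ℝ) / 2 - 1) * (2 * d * ((d : ℝ) ^ 3 * ((8 : ℝ) ^ d)⁻¹)) := by
        rw [hD]
        gcongr
    _ ≤ (lam : ℝ) ^ ((d : ℝ) / 2 - 1) * 1 := by gcongr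
    _ ≤ Real.pi ^ ((d : ℝ) / 2) * (lam : ℝ) ^ ((d : ℝ) / 2 - 1) := by
        rw [mul_one]
        exact le_mul_of_one_le_left (by positivity) hpi

/-- The lattice point count, with relative error `O(1 / d)`: one half comes from the error term of
the circle method, the other from truncating the singular series at `N = ⌊√lam⌋`. -/
theorem abs_ncard_sub_le {d lam : ℕ} (hd : 16 ≤ d) (hlam : 0 < lam)
    (h : radiusConst * (d : ℝ) ^ 3 ≤ (lam : ℝ)) :
    |((latticeSphere d lam).ncard : ℝ) - mainTerm d lam * (singularSeries d lam).re| ≤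
      mainTerm d lam * (2 / d) := by
  have hd16 : (16 : ℝ) ≤ d := by exact_mod_cast hd
  have hd' : (0 : ℝ) < d := by linarith
  have hm := mainTerm_pos (d := d) (by omega) hlam
  -- the tail of the singular series is at most `1 / (4 N)`, and `N = ⌊√lam⌋ ≥ d`
  have hNd : d ≤ Nat.sqrt lam := by
    rw [Nat.le_sqrt']
    have h1 : (d : ℝ) ^ 2 ≤ lam := by
      refine le_trans ?_ h
      have := sixteen_le_radiusConst
      have h3 : (d : ℝ) ^ 2 ≤ (d : ℝ) ^ 3 := pow_le_pow_right₀ (by linarith) (by norm_num)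
      refine h3.trans (le_mul_of_one_le_left (by positivity) (by linarith))
    exact_mod_cast h1
  have hNd' : (d : ℝ) ≤ Nat.sqrt lam := by exact_mod_cast hNd
  have h1 := norm_wHat_sub_majorOne_le (d := d) (by omega) hlam 0
  rw [wHat_zero, majorOne_at_zero (by omega)] at h1
  have h2 := h1.trans (error_le_mainTerm_div hd hlam h)
  have h3 := norm_singularSeries_sub_partial_le hd lam (M := Nat.sqrt lam) (by omega)
  have h4 : 1 / (4 * (Nat.sqrt lam : ℝ)) ≤ 1 / d := by
    apply one_div_le_one_div_of_le hd'
    linarith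
  have h5 := h3.trans h4
  set P := ∑ q ∈ Finset.Icc 1 (Nat.sqrt lam), singularTerm d lam q
  have hS : ((singularSeries d lam).re : ℂ) = singularSeries d lam :=
    Complex.ext (by simp) (by simp [singularSeries_im])
  have h6 : ‖((latticeSphere d lam).ncard : ℂ) - mainTerm d lam * singularSeries d lam‖ ≤
      mainTerm d lam * (2 / d) := by
    have e : ((latticeSphere d lam).ncard : ℂ) - mainTerm d lam * singularSeries d lam =
        (((latticeSphere d lam).ncard : ℂ) - mainTerm d lam * P) -
          mainTerm d lam * (singularSeries d lam - P) := by ring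
    rw [e]
    refine (norm_sub_le _ _).trans ?_
    rw [norm_mul, Complex.norm_real, Real.norm_of_nonneg hm.le]
    have h7 := mul_le_mul_of_nonneg_left h5 hm.le
    calc _ ≤ mainTerm d lam * (1 / d) + mainTerm d lam * (1 / d) := add_le_add h2 h7
      _ = _ := by ring
  rw [← hS] at h6
  have e2 : ((latticeSphere d lam).ncard : ℂ) - mainTerm d lam * ((singularSeries d lam).re : ℂ) =
      ((((latticeSphere d lam).ncard : ℝ) - mainTerm d lam * (singularSeries d lam).re : ℝ) : ℂ) := by
    push_cast; rfl
  rw [e2, Complex.norm_real, Real.norm_eq_abs] at h6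
  exact h6

theorem singularSeries_re_mem {d : ℕ} (hd : 16 ≤ d) (lam : ℕ) :
    1 / 2 ≤ (singularSeries d lam).re ∧ (singularSeries d lam).re ≤ 3 / 2 := by
  have h := (Complex.abs_re_le_norm _).trans (norm_singularSeries_sub_one_le hd lam)
  rw [Complex.sub_re, Complex.one_re, abs_le] at h
  constructor <;> linarith

end DimFreeWaring

open DimFreeWaring
theorem theorem3p1 :
    -- the singular series converges, is real, and lies between `1/2` and `3/2`
    (∀ d lam : ℕ, 16 ≤ d → 0 < lam →
      Summable (fun q : ℕ => singularTerm d lam q) ∧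
      (singularSeries d lam).im = 0 ∧
      1 / 2 ≤ (singularSeries d lam).re ∧ (singularSeries d lam).re ≤ 3 / 2) ∧
    ∃ C : ℝ, 0 < C ∧
      -- approximation of the exponential sum by the major arc terms
      (∃ K : ℝ, 0 < K ∧ ∀ d lam : ℕ, 5 ≤ d → 0 < lam → C * (d : ℝ) ^ 3 ≤ (lam : ℝ) →
        (∀ φ : ℝ → ℂ, IsCutoff φ → ∀ n : ℕ, 1 ≤ n → n ≤ Nat.sqrt lam + 1 →
          ∀ ξ : Fin d → ℝ,
            ‖wHat d lam ξ - majorOne d lam n ξ - majorTwo φ d lam n ξ‖ ≤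
              K ^ d * ((d : ℝ) * lam) ^ ((d : ℝ) / 4)) ∧
        (∀ ξ : Fin d → ℝ,
            ‖wHat d lam ξ - majorOne d lam (Nat.sqrt lam + 1) ξ‖ ≤
              K ^ d * ((d : ℝ) * lam) ^ ((d : ℝ) / 4))) ∧
      -- the asymptotic formula as `d → ∞`, uniformly in `lam ≥ C d ^ 3`
      (∀ ε : ℝ, 0 < ε → ∃ D : ℕ, ∀ d lam : ℕ, 16 ≤ d → D ≤ d → 0 < lam →
        C * (d : ℝ) ^ 3 ≤ (lam : ℝ) →
        ∃ η : ℝ, |η| ≤ ε ∧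
          ((latticeSphere d lam).ncard : ℂ) =
            (mainTerm d lam : ℂ) * singularSeries d lam * (1 + (η : ℂ))) ∧
      -- the two-sided bounds with absolute constants
      (∃ c₁ c₂ : ℝ, 0 < c₁ ∧ 0 < c₂ ∧ ∀ d lam : ℕ, 16 ≤ d → 0 < lam →
        C * (d : ℝ) ^ 3 ≤ (lam : ℝ) →
        c₁ * mainTerm d lam ≤ ((latticeSphere d lam).ncard : ℝ) ∧
        ((latticeSphere d lam).ncard : ℝ) ≤ c₂ * mainTerm d lam ∧
        c₁ * mainTerm d lam ≤
          (surfaceMeasure d).real Set.univ * (lam : ℝ) ^ ((d : ℝ) / 2 - 1) ∧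
        (surfaceMeasure d).real Set.univ * (lam : ℝ) ^ ((d : ℝ) / 2 - 1) ≤
          c₂ * mainTerm d lam) := by
  refine ⟨fun d lam hd _ => ⟨(summable_norm_singularTerm hd lam).of_norm, singularSeries_im d lam,
    singularSeries_re_mem hd lam⟩, radiusConst, by linarith [sixteen_le_radiusConst],
    ⟨errorBase, errorBase_pos, fun d lam hd hlam _ =>
      ⟨fun φ hφ n _ _ ξ => norm_wHat_sub_major_le hd hlam hφ n ξ,
        fun ξ => norm_wHat_sub_majorOne_le hd hlam ξ⟩⟩, ?_, ?_⟩
  · intro ε hε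
    obtain ⟨D, hD⟩ := exists_nat_ge (4 / ε)
    refine ⟨D, fun d lam hd hDd hlam hC => ?_⟩
    have hd16 : (16 : ℝ) ≤ d := by exact_mod_cast hd
    have hm := mainTerm_pos (d := d) (by omega) hlam
    have hs := (singularSeries_re_mem hd lam).1
    set s := (singularSeries d lam).re with hsdef
    have hS : singularSeries d lam = (s : ℂ) :=
      Complex.ext (by simp [hsdef]) (by simp [singularSeries_im])
    have hs0 : 0 < s := by linarith
    have hms : 0 < mainTerm d lam * s := mul_pos hm hs0
    have hb := abs_ncard_sub_le hd hlam hC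
    rw [← hsdef] at hb
    refine ⟨(((latticeSphere d lam).ncard : ℝ) - mainTerm d lam * s) / (mainTerm d lam * s),
      ?_, ?_⟩
    · rw [abs_div, abs_of_pos hms, div_le_iff₀ hms]
      have h4 : 4 / (d : ℝ) ≤ ε := by
        have : (D : ℝ) ≤ d := by exact_mod_cast hDd
        have h5 : 4 / ε ≤ d := hD.trans this
        rw [div_le_iff₀ hε] at h5
        rw [div_le_iff₀ (by linarith)]
        linarith
      calc _ ≤ mainTerm d lam * (2 / d) := hb
        _ = 4 / (d : ℝ) * (mainTerm d lam * (1 / 2)) := by ring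
        _ ≤ ε * (mainTerm d lam * s) := by gcongr
    · rw [hS]
      have h1 : (mainTerm d lam : ℂ) ≠ 0 := by exact_mod_cast hm.ne'
      have h2 : (s : ℂ) ≠ 0 := by exact_mod_cast hs0.ne'
      push_cast
      field_simp
      ring
  · refine ⟨1 / 4, 2, by norm_num, by norm_num, fun d lam hd hlam hC => ?_⟩
    have hd16 : (16 : ℝ) ≤ d := by exact_mod_cast hd
    have hm := mainTerm_pos (d := d) (by omega) hlam
    obtain ⟨hs1, hs2⟩ := singularSeries_re_mem hd lam
    have hb := abs_ncard_sub_le hd hlam hC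
    have h2 : 2 / (d : ℝ) ≤ 1 / 8 := by
      rw [div_le_div_iff₀ (by linarith) (by norm_num)]
      linarith
    have h3 := mul_le_mul_of_nonneg_left h2 hm.le
    have h4 := mul_le_mul_of_nonneg_left hs1 hm.le
    have h5 := mul_le_mul_of_nonneg_left hs2 hm.le
    rw [abs_le] at hb
    have hsurf : (surfaceMeasure d).real Set.univ * (lam : ℝ) ^ ((d : ℝ) / 2 - 1) =
        2 * mainTerm d lam := by
      rw [surfaceMeasure_real_univ (by omega), mainTerm]
      ring
    rw [hsurf]
    refine ⟨?_, ?_, ?_, le_rfl⟩ <;> linarith
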